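/- **Setting.** A random sequence of bits is *$\epsilon$-free* (Santha–Vazirani) given $e$ if, conditionally on $e$ and on any values of the previous bits, the next bit equals $0$ with probability in $[\frac12-\epsilon,\frac12+\epsilon]$. A tripartite behaviour $P(a,b,c|x,y,z)$ with all variables in $\{0,1\}$ is *quantum* if $P(a,b,c|x,y,z)=\langle\psi|A_x^aB_y^bC_z^c|\psi\rangle$ for a unit vector $\psi$ of a Hilbert space and projective measurements of the three parties that commute with each other. *The function $g$.* In the Mermin game the settings are $x,y$ and $z=x\oplus y\oplus1$, and the round is won if $a\oplus b\oplus c=xy$. Let $\mathcal Q_{1+AB+AC+BC}$ be the set of families of probability distributions $P(a,b,c|x,y,z)$ allowed by the Navascués–Pironio–Acín relaxation with operator sequences $1,A_x,B_y,C_z,A_xB_y,A_xC_z,B_yC_z$ (projectors on outcome $0$; real positive semidefinite certificate). Let $\frac12+g(\epsilon,p)$ be the supremum of $\sum_{b,c}P(i,b,c|x,y,x\oplus y\oplus1)$ over $i,x,y\in\{0,1\}$ and over all $P\in\mathcal Q_{1+AB+AC+BC}$ with $$\frac14\sum_{x,y}P(a\oplus b\oplus c=xy\,|\,x,y,x\oplus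 y\oplus1)\ \ge\ 1-\frac{1-p}{(\frac12-\epsilon)^2}.$$ *Protocol with $N$ iterations.* Let $e$ be the adversary's knowledge. A source that is $\epsilon$-free given $e$ produces the settings $x_1,y_1,\dots,x_N,y_N$ and then the hashing bits $h_1,\dots,h_N$. In iteration $i$ a tripartite box receives $x_i$, $y_i$, $z_i=x_i\oplus y_i\oplus1$ and outputs $a_i,b_i,c_i$ according to a quantum behaviour that may depend on $e$ and on the settings and outcomes of all previous iterations; source and box are correlated only through $e$. Let $P_{est}$ be the fraction of iterations that are won and $r(q,N)=\sqrt{-\ln(1-q)}\,N^{-1/2}$. The test is passed if $$\eta_{est}=g\bigl(\epsilon,P_{est}-r(q,N)\bigr)<\frac1{1+2\epsilon}-\frac12,$$ and then the output bit is $y=\bigoplus_{i=1}^Nh_ia_i$. **Theorem.** For all $0<\epsilon'<\epsilon<\frac12$ and $0\le q<1$ there is $N_0$ such that for every $N\ge N_0$: 1. a perfect score passes the test: $g(\epsilon,1-r(q,N))<\frac1{1+2\epsilon}-\frac12$; 2. for every such source and box and every value $e$ of the adversary's knowledge, with probability at least $q$ the bit $y$ is $\epsilon'$-free when the test is passed;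 that is, there is an event $G$, determined by the settings and outcomes of all iterations, such that $P(G\mid e)\ge q$ and, if $P(G,\ \text{test passed}\mid e)>0$, then for $v\in\{0,1\}$ $$\tfrac12-\epsilon'\ \le\ P(y=v\mid G,\ \text{test passed},\ e)\ \le\ \tfrac12+\epsilon'.$$ -/

import Mathlib

noncomputable section

namespace MerminAmp

/-! Bits are Booleans, with `false` for 0 and `true` for 1. -/

/-! ### Finite probability -/

open Classical in
/-- Probability of the event `A` for the probability mass function `m` on a finite set. -/
def prob {Ω : Type*} [Fintype Ω] (m : Ω → ℝ) (A : Set Ω) : ℝ :=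
  ∑ ω, if ω ∈ A then m ω else 0

/-- Conditional probability of `A` given `B` (meaningful when `B` has positive probability). -/
def condProb {Ω : Type*} [Fintype Ω] (m : Ω → ℝ) (A B : Set Ω) : ℝ :=
  prob m (A ∩ B) / prob m B

/-- A law on bit strings of length `n` is an `ε`-free Santha–Vazirani source: given any string of
previous bits (that occurs with positive probability), the next bit is `0` with conditional
probability in `[1/2 - ε, 1/2 + ε]`. -/
def IsSanthaVazirani (ε : ℝ) {n : ℕ} (μ : PMF (Fin n → Bool)) : Prop :=
  ∀ (i : Fin n) (w : Fin n → Bool),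
    0 < prob (fun v => (μ v).toReal) {v | ∀ j, j < i → v j = w j} →
      condProb (fun v => (μ v).toReal) {v | v i = false} {v | ∀ j, j < i → v j = w j}
        ∈ Set.Icc (1 / 2 - ε) (1 / 2 + ε)

/-! ### Tripartite behaviours -/

/-- `P a b c x y z` is the probability `P(a,b,c|x,y,z)` of the outcomes `a, b, c` of Alice, Bob
and Charlie for the settings `x, y, z`. -/
abbrev Behavior := Bool → Bool → Bool → Bool → Bool → Bool → ℝ

/-- The operators `M s o` (setting `s`, outcome `o`) form a projective measurement for every
setting. -/
def IsProjectiveMeasurement {H : Type*} [NormedAddCommGroup H] [InnerProductSpace ℂ H]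
    [CompleteSpace H] (M : Bool → Bool → H →L[ℂ] H) : Prop :=
  (∀ s o, IsSelfAdjoint (M s o)) ∧
  (∀ s o o', o ≠ o' → M s o * M s o' = 0) ∧
  (∀ s, ∑ o, M s o = 1)

/-- A behaviour is quantum if it is realized by commuting projective measurements of the three
parties on a unit vector of a Hilbert space. -/
def IsQuantum (P : Behavior) : Prop :=
  ∃ (H : Type) (_ : NormedAddCommGroup H) (_ : InnerProductSpace ℂ H) (_ : CompleteSpace H)
    (ψ : H) (A B C : Bool → Bool → H →L[ℂ] H),
    ‖ψ‖ = 1 ∧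
    IsProjectiveMeasurement A ∧ IsProjectiveMeasurement B ∧ IsProjectiveMeasurement C ∧
    (∀ x a y b, Commute (A x a) (B y b)) ∧
    (∀ x a z c, Commute (A x a) (C z c)) ∧
    (∀ y b z c, Commute (B y b) (C z c)) ∧
    ∀ a b c x y z, (P a b c x y z : ℂ) = inner ℂ ψ ((A x a * B y b * C z c) ψ)

/-- The third setting `z = x ⊕ y ⊕ 1` of the Mermin game. -/
def thirdSetting (x y : Bool) : Bool := xor (xor x y) true

/-- Winning condition `a ⊕ b ⊕ c = x y` of the Mermin game. -/
def Wins (x y a b c : Bool) : Prop := xor (xor a b) c = (x && y)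

instance (x y a b c : Bool) : Decidable (Wins x y a b c) :=
  inferInstanceAs (Decidable (_ = _))

/-- Probability of winning the Mermin game when the settings are `x`, `y`, `x ⊕ y ⊕ 1`. -/
def winProb (P : Behavior) (x y : Bool) : ℝ :=
  ∑ a, ∑ b, ∑ c, if Wins x y a b c then P a b c x y (thirdSetting x y) else 0

/-- Success probability of the unbiased Mermin game. -/
def unbiasedWinProb (P : Behavior) : ℝ := 1 / 4 * ∑ x, ∑ y, winProb P x y

/-- Alice's marginal `P_A(a|x,y,z)`. -/
def aliceMarginal (P : Behavior) (a x y z : Bool) : ℝ := ∑ b, ∑ c, P a b c x y z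

/-! ### The Navascués–Pironio–Acín relaxation of level `1 + AB + AC + BC` -/

/-- The 19 operator sequences `1, A_x, B_y, C_z, A_x B_y, A_x C_z, B_y C_z`, where `A_x`, `B_y`,
`C_z` are the projectors on the outcome 0. The three components are the operators of Alice, Bob
and Charlie that occur in the sequence, at least one party being absent. -/
abbrev NPAIndex :=
  {w : Option Bool × Option Bool × Option Bool // w.1 = none ∨ w.2.1 = none ∨ w.2.2 = none}

/-- One party's part of the product `O† O'`, reduced by idempotence of projectors. -/
def reducedPart : Option Bool → Option Bool → List Bool
  | none, none => []
  | none, some s => [s]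
  | some s, none => [s]
  | some s, some s' => if s = s' then [s] else [s, s']

/-- The product `O† O'` of two operator sequences in normal form: operators of distinct parties
commute, so it is given by the reduced words of the three parties. -/
def reducedProduct (u v : NPAIndex) : List Bool × List Bool × List Bool :=
  (reducedPart u.1.1 v.1.1, reducedPart u.1.2.1 v.1.2.1, reducedPart u.1.2.2 v.1.2.2)

/-- The empty operator sequence. -/
def idx1 : NPAIndex := ⟨(none, none, none), by simp⟩
/-- The sequence `A_x`. -/
def idxA (x : Bool) : NPAIndex := ⟨(some x, none, none), by simp⟩
/-- The sequence `B_y`. -/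
def idxB (y : Bool) : NPAIndex := ⟨(none, some y, none), by simp⟩
/-- The sequence `C_z`. -/
def idxC (z : Bool) : NPAIndex := ⟨(none, none, some z), by simp⟩
/-- The sequence `A_x B_y`. -/
def idxAB (x y : Bool) : NPAIndex := ⟨(some x, some y, none), by simp⟩

/-- `P` belongs to the relaxation of level `1 + AB + AC + BC`: it is a family of probability
distributions that admits a real certificate `Γ`. The equations between `Γ` and `P` determine all
of `P` and include normalization and no-signaling. -/
def InNPALevel (P : Behavior) : Prop :=
  (∀ a b c x y z, 0 ≤ P a b c x y z) ∧
  ∃ Γ : Matrix NPAIndex NPAIndex ℝ,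
    Γ.PosSemidef ∧
    Γ idx1 idx1 = 1 ∧
    (∀ u v u' v', reducedProduct u v = reducedProduct u' v' → Γ u v = Γ u' v') ∧
    ∀ x y z,
      (∑ a, ∑ b, ∑ c, P a b c x y z) = 1 ∧
      (∑ b, ∑ c, P false b c x y z) = Γ idx1 (idxA x) ∧
      (∑ a, ∑ c, P a false c x y z) = Γ idx1 (idxB y) ∧
      (∑ a, ∑ b, P a b false x y z) = Γ idx1 (idxC z) ∧
      (∑ c, P false false c x y z) = Γ (idxA x) (idxB y) ∧
      (∑ b, P false b false x y z) = Γ (idxA x) (idxC z) ∧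
      (∑ a, P a false false x y z) = Γ (idxB y) (idxC z) ∧
      P false false false x y z = Γ (idxAB x y) (idxC z)

/-- The function `g(ε, p)`: the value of the relaxed optimization problem
"maximize `P_A(i|x,y,x⊕y⊕1)` over `i, x, y` and over all `P` in the relaxation whose success
probability in the unbiased game is at least `1 - (1 - p)/(1/2 - ε)²`", minus `1/2`. -/
def g (ε p : ℝ) : ℝ :=
  sSup {v : ℝ | ∃ P : Behavior, InNPALevel P ∧
      1 - (1 - p) / (1 / 2 - ε) ^ 2 ≤ unbiasedWinProb P ∧
      ∃ i x y, v = aliceMarginal P i x y (thirdSetting x y)} - 1 / 2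

/-- The estimation margin `r(q, N) = √(-ln (1 - q)) N^(-1/2)`. -/
def r (q : ℝ) (N : ℕ) : ℝ := √(-Real.log (1 - q)) / √(N : ℝ)

/-! ### The protocol -/

/-- The record of one iteration: settings `x, y` (the third one is `x ⊕ y ⊕ 1`) and outcomes. -/
structure Round where
  x : Bool
  y : Bool
  a : Bool
  b : Bool
  c : Bool

/-- Records of all iterations. -/
abbrev Transcript (N : ℕ) := Fin N → Round

/-- The records of the iterations before the `i`-th one, in order. -/
def history {N : ℕ} (t : Transcript N) (i : Fin N) : List Round :=
  List.ofFn fun j : Fin i => t ⟨j, j.isLt.trans i.isLt⟩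

/-- Setting `x_i`, read off the string of source bits `x_1 y_1 x_2 y_2 … x_N y_N h_1 … h_N`. -/
def xBit {N : ℕ} (v : Fin (3 * N) → Bool) (i : Fin N) : Bool := v ⟨2 * i, by omega⟩
/-- Setting `y_i`. -/
def yBit {N : ℕ} (v : Fin (3 * N) → Bool) (i : Fin N) : Bool := v ⟨2 * i + 1, by omega⟩
/-- Hashing bit `h_i`. -/
def hBit {N : ℕ} (v : Fin (3 * N) → Bool) (i : Fin N) : Bool := v ⟨2 * N + i, by omega⟩

/-- Elementary outcomes of the protocol: the source bits and the outcomes `(a_i, b_i, c_i)`. -/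
abbrev Outcome (N : ℕ) := (Fin (3 * N) → Bool) × (Fin N → Bool × Bool × Bool)

/-- The records of all iterations. -/
def transcript {N : ℕ} (ω : Outcome N) : Transcript N := fun i =>
  ⟨xBit ω.1 i, yBit ω.1 i, (ω.2 i).1, (ω.2 i).2.1, (ω.2 i).2.2⟩

/-- The devices for `N` iterations, correlated with an adversary whose knowledge takes values in
`E`. For every value `e` of the knowledge there is an `ε`-free Santha–Vazirani source that produces
the `2 N` setting bits followed by the `N` hashing bits, and a tripartite quantum box; the behaviour
of the box in an iteration may depend on `e` and on the records of all previous iterations. -/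
structure Devices (ε : ℝ) (E : Type*) (N : ℕ) where
  source : E → PMF (Fin (3 * N) → Bool)
  source_free : ∀ e, IsSanthaVazirani ε (source e)
  box : E → List Round → Behavior
  box_quantum : ∀ e l, IsQuantum (box e l)

/-- The joint law, given `e`, of the source bits and of all outcomes of the box. Source and box are
correlated only through `e`: given `e` and the settings, the outcomes do not depend on the
hashing bits nor on later settings. -/
def Devices.law {ε : ℝ} {E : Type*} {N : ℕ} (D : Devices ε E N) (e : E) (ω : Outcome N) : ℝ :=
  (D.source e ω.1).toReal *
    ∏ i, D.box e (history (transcript ω) i) (ω.2 i).1 (ω.2 i).2.1 (ω.2 i).2.2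
      (xBit ω.1 i) (yBit ω.1 i) (thirdSetting (xBit ω.1 i) (yBit ω.1 i))

/-- The observed average success probability `P_est`: the fraction of iterations that are won. -/
def pEst {N : ℕ} (t : Transcript N) : ℝ :=
  ((Finset.univ.filter fun i => Wins (t i).x (t i).y (t i).a (t i).b (t i).c).card : ℝ) / N

/-- The test condition `g(ε, P_est - r(q, N)) < 1/(1 + 2 ε) - 1/2`. -/
def Passes (ε q : ℝ) {N : ℕ} (t : Transcript N) : Prop :=
  g ε (pEst t - r q N) < 1 / (1 + 2 * ε) - 1 / 2

/-- The output bit `⊕ h_i a_i`. -/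
def outputBit {N : ℕ} (ω : Outcome N) : Bool :=
  decide (Odd (∑ i, (hBit ω.1 i && (ω.2 i).1).toNat))

end MerminAmp

end

noncomputable section

namespace MerminAmp

open Finset

/-! ### Quantum behaviours and the relaxation -/

section Quantum

variable {H : Type*} [NormedAddCommGroup H] [InnerProductSpace ℂ H] [CompleteSpace H]

/-! The output bit is a linear hash of Alice's string. Given the settings, every string of hashing
bits has probability at most (1/2 + ε)^N, so Cauchy–Schwarz and Parseval for the characters of the
cube bound the squared signed expectation of the output bit on an event S by (1 + 2ε)^N M, where M
bounds the product of Alice's outcome probabilities along every transcript in S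
(`Devices.sq_signed_prob_le`). It suffices that M = m^N with m(1 + 2ε) < 1. By AM–GM
(`prod_le_pow_of_sum_le`) it is enough that these probabilities average at most m along each
transcript.

The score controls this average. Every pair of settings has probability at least (1/2 - ε)², so a
round is lost with conditional probability at least 4(1/2 - ε)²(1 - w), with w the unbiased winning
probability of the current behaviour. A Chernoff bound adapted to the history (`sum_excess_ge_le`)
converts the observed score into a bound on the average defect 1 - w. Symmetries of the game align
the marginals of all rounds, and `exists_average` produces one point of the relaxation with the
average defect and the average marginal, to which the definition of `g` applies.

The test is a strict inequality without a uniform gap. The gap comes from the constraint defining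
`g`, which allows four times the defect that the score implies. If the allowed defect is at least a
constant d, there is room to mix in a deterministic strategy with marginal 1, which pushes the
original marginal below the threshold by a fixed amount. If it is below d, a quantitative GHZ
argument (`InNPALevel.aliceMarginal_le`) puts the marginal near 1/2. This argument also shows that
near-perfect scores pass. Since the slack absorbs fluctuations of constant size per round, the
margin `r` enters only through nonnegativity and convergence to 0. -/

lemma IsProjectiveMeasurement.mul_self {M : Bool → Bool → H →L[ℂ] H}
    (hM : IsProjectiveMeasurement M) (s o : Bool) : M s o * M s o = M s o := by
  have h1 := hM.2.2 s
  rw [Fintype.sum_bool] at h1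
  have h2 := hM.2.1 s o (!o) (by cases o <;> decide)
  calc M s o * M s o = M s o * (M s true + M s false) := by
        cases o
        · rw [mul_add, show M s false * M s true = 0 from h2, zero_add]
        · rw [mul_add, show M s true * M s false = 0 from h2, add_zero]
    _ = M s o := by rw [h1, mul_one]

/-- The projector of one party occurring in an operator sequence, if any. -/
def optProj (M : Bool → Bool → H →L[ℂ] H) : Option Bool → H →L[ℂ] H
  | none => 1
  | some s => M s false

/-- The product of the projectors of one party along a word. -/
def wordProj (M : Bool → Bool → H →L[ℂ] H) (l : List Bool) : H →L[ℂ] H :=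
  (l.map fun s => M s false).prod

lemma IsProjectiveMeasurement.optProj_mul {M : Bool → Bool → H →L[ℂ] H}
    (hM : IsProjectiveMeasurement M) (u v : Option Bool) :
    optProj M u * optProj M v = wordProj M (reducedPart u v) := by
  rcases u with _ | s <;> rcases v with _ | s'
  · simp [optProj, wordProj, reducedPart]
  · simp [optProj, wordProj, reducedPart]
  · simp [optProj, wordProj, reducedPart]
  · by_cases h : s = s'
    · subst h
      simp [optProj, wordProj, reducedPart, hM.mul_self]
    · simp [optProj, wordProj, reducedPart, h]

lemma IsProjectiveMeasurement.isSelfAdjoint_optProj {M : Bool → Bool → H →L[ℂ] H}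
    (hM : IsProjectiveMeasurement M) (u : Option Bool) : IsSelfAdjoint (optProj M u) := by
  rcases u with _ | s
  · exact IsSelfAdjoint.one _
  · exact hM.1 s false

omit [CompleteSpace H] in
lemma commute_optProj {M M' : Bool → Bool → H →L[ℂ] H}
    (h : ∀ s o s' o', Commute (M s o) (M' s' o')) (u v : Option Bool) :
    Commute (optProj M u) (optProj M' v) := by
  rcases u with _ | s <;> rcases v with _ | s'
  · exact Commute.one_left _
  · exact Commute.one_left _
  · exact Commute.one_right _
  · exact h _ _ _ _

lemma star_mul_of_commute {R : Type*} [Monoid R] [StarMul R] {a b c a' b' c' : R}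
    (ha : IsSelfAdjoint a) (hb : IsSelfAdjoint b) (hc : IsSelfAdjoint c)
    (hab : Commute a b) (hac : Commute a c) (hbc : Commute b c)
    (hba' : Commute b a') (hca' : Commute c a') (hcb' : Commute c b') :
    star (a * b * c) * (a' * b' * c') = a * a' * (b * b') * (c * c') := by
  rw [star_mul, star_mul, ha.star_eq, hb.star_eq, hc.star_eq]
  calc c * (b * a) * (a' * b' * c') = c * (a * b) * (a' * b' * c') := by rw [hab.eq]
    _ = (c * a) * b * a' * b' * c' := by simp only [mul_assoc]
    _ = (a * c) * b * a' * b' * c' := by rw [hac.eq]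
    _ = a * (c * b) * a' * b' * c' := by simp only [mul_assoc]
    _ = a * (b * c) * a' * b' * c' := by rw [hbc.eq]
    _ = a * b * (c * a') * b' * c' := by simp only [mul_assoc]
    _ = a * b * (a' * c) * b' * c' := by rw [hca'.eq]
    _ = a * (b * a') * (c * b') * c' := by simp only [mul_assoc]
    _ = a * (a' * b) * (b' * c) * c' := by rw [hba'.eq, hcb'.eq]
    _ = a * a' * (b * b') * (c * c') := by simp only [mul_assoc]

/-- The certificate is the Gram matrix of the vectors O_u ψ for the underlying real inner product,
that is, the real part of the complex moment matrix. Its entries depend only on the reduced words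
because the parties commute and projectors are idempotent. -/
lemma IsQuantum.inNPALevel {P : Behavior} (hP : IsQuantum P) : InNPALevel P := by
  obtain ⟨H, _, _, _, ψ, A, B, C, hψ, hA, hB, hC, hAB, hAC, hBC, hP⟩ := hP
  let φ : (H →L[ℂ] H) →ₗ[ℝ] ℝ :=
    { toFun := fun X => (inner ℂ ψ (X ψ) : ℂ).re
      map_add' := fun X Y => by simp
      map_smul' := fun c X => by simp [inner_smul_right_eq_smul] }
  have hφ : ∀ X, φ X = (inner ℂ ψ (X ψ) : ℂ).re := fun _ => rfl
  have hPφ : ∀ a b c x y z, P a b c x y z = φ (A x a * B y b * C z c) := by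
    intro a b c x y z
    rw [hφ, ← hP, Complex.ofReal_re]
  have hφstar : ∀ X Y : H →L[ℂ] H, φ (star X * Y) = (inner ℂ (X ψ) (Y ψ) : ℂ).re := by
    intro X Y
    rw [hφ, mul_apply_eq_comp, ContinuousLinearMap.star_eq_adjoint,
      ContinuousLinearMap.adjoint_inner_right]
  have hφ1 : φ 1 = 1 := by
    rw [hφ]
    simp [inner_self_eq_norm_sq_to_K, hψ]
  have sA : ∀ x, A x true + A x false = 1 := fun x => by
    rw [← Fintype.sum_bool]; exact hA.2.2 x
  have sB : ∀ x, B x true + B x false = 1 := fun x => by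
    rw [← Fintype.sum_bool]; exact hB.2.2 x
  have sC : ∀ x, C x true + C x false = 1 := fun x => by
    rw [← Fintype.sum_bool]; exact hC.2.2 x
  let O : NPAIndex → H →L[ℂ] H := fun u => optProj A u.1.1 * optProj B u.1.2.1 * optProj C u.1.2.2
  let _ : InnerProductSpace ℝ H := InnerProductSpace.complexToReal
  have hΓ : ∀ u v, Matrix.gram ℝ (fun u => O u ψ) u v =
      φ (wordProj A (reducedProduct u v).1 * wordProj B (reducedProduct u v).2.1 *
        wordProj C (reducedProduct u v).2.2) := by
    intro u v
    have hBA : ∀ s o s' o', Commute (B s o) (A s' o') := fun s o s' o' => (hAB s' o' s o).symm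
    have hCA : ∀ s o s' o', Commute (C s o) (A s' o') := fun s o s' o' => (hAC s' o' s o).symm
    have hCB : ∀ s o s' o', Commute (C s o) (B s' o') := fun s o s' o' => (hBC s' o' s o).symm
    have key := star_mul_of_commute (hA.isSelfAdjoint_optProj u.1.1)
      (hB.isSelfAdjoint_optProj u.1.2.1) (hC.isSelfAdjoint_optProj u.1.2.2)
      (commute_optProj hAB _ _) (commute_optProj hAC _ _) (commute_optProj hBC _ _)
      (commute_optProj hBA u.1.2.1 v.1.1) (commute_optProj hCA u.1.2.2 v.1.1)
      (commute_optProj hCB u.1.2.2 v.1.2.1) (c' := optProj C v.1.2.2)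
    rw [Matrix.gram_apply, real_inner_eq_re_inner ℂ]
    refine (hφstar (O u) (O v)).symm.trans ?_
    rw [show star (O u) * O v = _ from key, hA.optProj_mul, hB.optProj_mul, hC.optProj_mul]
    rfl
  refine ⟨fun a b c x y z => ?_, Matrix.gram ℝ (fun u => O u ψ), Matrix.posSemidef_gram ℝ _, ?_, ?_,
    fun x y z => ?_⟩
  -- A product X of commuting projectors satisfies X* X = X, so each probability is a squared norm.
  · have key := star_mul_of_commute (hA.1 x a) (hB.1 y b) (hC.1 z c) (hAB x a y b) (hAC x a z c)
      (hBC y b z c) (hAB x a y b).symm (hAC x a z c).symm (hBC y b z c).symm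
      (c' := C z c)
    rw [hA.mul_self, hB.mul_self, hC.mul_self] at key
    rw [hPφ, ← key, hφstar]
    exact inner_self_nonneg (𝕜 := ℂ)
  · rw [hΓ]
    simp [reducedProduct, reducedPart, idx1, wordProj, hφ1]
  · intro u v u' v' h
    rw [hΓ, hΓ, h]
  · simp only [hΓ, reducedProduct, reducedPart, idx1, idxA, idxB, idxC, idxAB, wordProj, hPφ,
      Fintype.sum_bool, List.map_nil, List.map_cons, List.prod_nil, List.prod_cons, mul_one, one_mul,
      ← map_add, ← mul_add, ← add_mul, sA, sB, sC, hφ1, and_self]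

end Quantum

/-! ### Elementary properties of the relaxation -/

lemma convex_inNPALevel : Convex ℝ {P : Behavior | InNPALevel P} := by
  rintro P ⟨hP0, Γ, hΓ, hΓ1, hΓr, hΓP⟩ Q ⟨hQ0, Δ, hΔ, hΔ1, hΔr, hΔQ⟩ s t hs ht hst
  refine ⟨fun a b c x y z => ?_, s • Γ + t • Δ, (hΓ.smul hs).add (hΔ.smul ht), ?_,
    fun u v u' v' h => ?_, fun x y z => ?_⟩
  · exact add_nonneg (mul_nonneg hs (hP0 ..)) (mul_nonneg ht (hQ0 ..))
  · simp [hΓ1, hΔ1, hst]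
  · simp [hΓr u v u' v' h, hΔr u v u' v' h]
  · have h1 := hΓP x y z
    have h2 := hΔQ x y z
    simp only [Fintype.sum_bool, Matrix.add_apply, Matrix.smul_apply, Pi.add_apply, Pi.smul_apply,
      smul_eq_mul] at h1 h2 ⊢
    obtain ⟨a0, a1, a2, a3, a4, a5, a6, a7⟩ := h1
    obtain ⟨b0, b1, b2, b3, b4, b5, b6, b7⟩ := h2
    refine ⟨?_, ?_, ?_, ?_, ?_, ?_, ?_, ?_⟩
    · linear_combination s * a0 + t * b0 + hst
    · linear_combination s * a1 + t * b1
    · linear_combination s * a2 + t * b2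
    · linear_combination s * a3 + t * b3
    · linear_combination s * a4 + t * b4
    · linear_combination s * a5 + t * b5
    · linear_combination s * a6 + t * b6
    · linear_combination s * a7 + t * b7

/-- The winning probability of the unbiased game as a linear functional. -/
def unbiasedWinProbLin : Behavior →ₗ[ℝ] ℝ where
  toFun := unbiasedWinProb
  map_add' P Q := by
    simp [unbiasedWinProb, winProb, Wins, thirdSetting]
    ring
  map_smul' c P := by
    simp [unbiasedWinProb, winProb, Wins, thirdSetting]
    ring

/-- Alice's marginal as a linear functional. -/
def aliceMarginalLin (a x y z : Bool) : Behavior →ₗ[ℝ] ℝ where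
  toFun P := aliceMarginal P a x y z
  map_add' P Q := by
    simp [aliceMarginal]
    ring
  map_smul' c P := by
    simp [aliceMarginal]
    ring

section

variable {P : Behavior}

lemma InNPALevel.aliceMarginal_nonneg (hP : InNPALevel P) (a x y z : Bool) :
    0 ≤ aliceMarginal P a x y z :=
  sum_nonneg fun _ _ => sum_nonneg fun _ _ => hP.1 ..

lemma InNPALevel.sum_aliceMarginal (hP : InNPALevel P) (x y z : Bool) :
    ∑ a, aliceMarginal P a x y z = 1 := by
  obtain ⟨-, Γ, -, -, -, h⟩ := hP
  exact (h x y z).1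

lemma InNPALevel.aliceMarginal_le_one (hP : InNPALevel P) (a x y z : Bool) :
    aliceMarginal P a x y z ≤ 1 :=
  hP.sum_aliceMarginal x y z ▸
    single_le_sum (f := fun a => aliceMarginal P a x y z)
      (fun a _ => hP.aliceMarginal_nonneg a x y z) (mem_univ a)

lemma InNPALevel.winProb_nonneg (hP : InNPALevel P) (x y : Bool) : 0 ≤ winProb P x y := by
  refine sum_nonneg fun a _ => sum_nonneg fun b _ => sum_nonneg fun c _ => ?_
  split_ifs
  · exact hP.1 ..
  · exact le_rfl

lemma InNPALevel.winProb_le_one (hP : InNPALevel P) (x y : Bool) : winProb P x y ≤ 1 := by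
  rw [← hP.sum_aliceMarginal x y (thirdSetting x y)]
  refine sum_le_sum fun a _ => sum_le_sum fun b _ => sum_le_sum fun c _ => ?_
  split_ifs
  · exact le_rfl
  · exact hP.1 ..

lemma InNPALevel.unbiasedWinProb_nonneg (hP : InNPALevel P) : 0 ≤ unbiasedWinProb P :=
  mul_nonneg (by norm_num) (sum_nonneg fun _ _ => sum_nonneg fun _ _ => hP.winProb_nonneg ..)

lemma InNPALevel.unbiasedWinProb_le_one (hP : InNPALevel P) : unbiasedWinProb P ≤ 1 := by
  have h := hP.winProb_le_one
  simp only [unbiasedWinProb, Fintype.sum_bool]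
  linarith [h true true, h true false, h false true, h false false]

end

/-! ### Symmetries of the Mermin game -/

/-- Relabelling of settings and outcomes that preserves the Mermin game and sends Alice's outcome
`false` for the settings `false, false` to the outcome `i` for the settings `x₀, y₀`. -/
def relabel (i x₀ y₀ : Bool) (P : Behavior) : Behavior := fun a b c x y z =>
  P (xor a (xor (x && y₀) i)) (xor b (xor (y && x₀) (xor i (x₀ && y₀)))) c
    (xor x x₀) (xor y y₀) (xor z (xor x₀ y₀))

lemma IsProjectiveMeasurement.relabel {H : Type*} [NormedAddCommGroup H] [InnerProductSpace ℂ H]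
    [CompleteSpace H] {M : Bool → Bool → H →L[ℂ] H} (hM : IsProjectiveMeasurement M) (s₀ : Bool)
    (f : Bool → Bool) : IsProjectiveMeasurement fun s o => M (xor s s₀) (xor o (f s)) := by
  refine ⟨fun s o => hM.1 _ _, fun s o o' h => hM.2.1 _ _ _ (by simpa using h), fun s => ?_⟩
  rw [← hM.2.2 (xor s s₀), Fintype.sum_bool, Fintype.sum_bool]
  cases h : f s <;> simp [h, add_comm]

lemma IsQuantum.relabel {P : Behavior} (hP : IsQuantum P) (i x₀ y₀ : Bool) :
    IsQuantum (relabel i x₀ y₀ P) := by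
  obtain ⟨H, _, _, _, ψ, A, B, C, hψ, hA, hB, hC, hAB, hAC, hBC, hP⟩ := hP
  refine ⟨H, _, _, _, ψ, _, _, _, hψ, hA.relabel x₀ fun x => xor (x && y₀) i,
    hB.relabel y₀ fun y => xor (y && x₀) (xor i (x₀ && y₀)),
    hC.relabel (xor x₀ y₀) fun _ => false, fun _ _ _ _ => hAB .., fun _ _ _ _ => hAC ..,
    fun _ _ _ _ => hBC .., fun a b c x y z => ?_⟩
  simp [MerminAmp.relabel, hP]

/-- The relabelling permutes the four questions, and xy ⊕ xy₀ ⊕ x₀y ⊕ x₀y₀ = (x ⊕ x₀)(y ⊕ y₀)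
matches their winning conditions; the flip by i cancels between Alice and Bob. -/
lemma unbiasedWinProb_relabel (i x₀ y₀ : Bool) (P : Behavior) :
    unbiasedWinProb (relabel i x₀ y₀ P) = unbiasedWinProb P := by
  cases i <;> cases x₀ <;> cases y₀ <;>
  · simp [unbiasedWinProb, winProb, Wins, thirdSetting, relabel]
    try ring

lemma aliceMarginal_relabel (i x₀ y₀ : Bool) (P : Behavior) :
    aliceMarginal (relabel i x₀ y₀ P) false false false (thirdSetting false false) =
      aliceMarginal P i x₀ y₀ (thirdSetting x₀ y₀) := by
  cases i <;> cases x₀ <;> cases y₀ <;>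
  · simp [aliceMarginal, thirdSetting, relabel]
    try ring

/-! ### The deterministic strategy -/

/-- All parties always answer `false`. -/
def constFalse : Behavior := fun a b c _ _ _ => if a = false ∧ b = false ∧ c = false then 1 else 0

lemma isProjectiveMeasurement_const {H : Type*} [NormedAddCommGroup H] [InnerProductSpace ℂ H]
    [CompleteSpace H] :
    IsProjectiveMeasurement fun _ o : Bool => if o = false then (1 : H →L[ℂ] H) else 0 := by
  refine ⟨fun s o => ?_, fun s o o' h => ?_, fun s => by simp⟩
  · cases o
    · simp
    · simp
  · cases o <;> cases o' <;> simp_all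

lemma isQuantum_constFalse : IsQuantum constFalse := by
  refine ⟨ℂ, inferInstance, inferInstance, inferInstance, 1, _, _, _, by simp,
    isProjectiveMeasurement_const, isProjectiveMeasurement_const, isProjectiveMeasurement_const,
    fun _ a _ b => ?_, fun _ a _ b => ?_, fun _ a _ b => ?_, fun a b c _ _ _ => ?_⟩
  · cases a <;> cases b <;> simp
  · cases a <;> cases b <;> simp
  · cases a <;> cases b <;> simp
  · cases a <;> cases b <;> cases c <;> simp [constFalse]

lemma unbiasedWinProb_constFalse : unbiasedWinProb constFalse = 3 / 4 := by
  simp only [unbiasedWinProb, winProb, Wins, constFalse, Fintype.sum_bool]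
  norm_num

lemma aliceMarginal_constFalse (x y z : Bool) : aliceMarginal constFalse false x y z = 1 := by
  simp only [aliceMarginal, constFalse, Fintype.sum_bool]
  norm_num

/-! ### The marginals of near-perfect behaviours -/

lemma exists_gram_of_posSemidef {n : Type*} [Fintype n] [DecidableEq n] {M : Matrix n n ℝ}
    (hM : M.PosSemidef) : ∃ V : n → EuclideanSpace ℝ n, ∀ i j, M i j = inner ℝ (V i) (V j) := by
  open scoped MatrixOrder in
  obtain ⟨B, hB⟩ := CStarAlgebra.nonneg_iff_eq_star_mul_self.mp hM.nonneg
  refine ⟨fun i => WithLp.toLp 2 fun k => B k i, fun i j => ?_⟩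
  rw [hB, Matrix.mul_apply, PiLp.inner_apply]
  refine sum_congr rfl fun k _ => ?_
  simp [Matrix.star_apply, mul_comm]

/-! ### Nearby unit vectors -/

section

variable {F : Type*} [NormedAddCommGroup F] [InnerProductSpace ℝ F]

lemma norm_sub_le_of_inner {u v : F} {s : ℝ} (hu : ‖u‖ = 1) (hv : ‖v‖ = 1) (hs : 0 ≤ s)
    (h : 1 - s ^ 2 / 2 ≤ inner ℝ u v) : ‖u - v‖ ≤ s := by
  refine abs_le_of_sq_le_sq' ?_ hs |>.2
  rw [norm_sub_sq_real, hu, hv]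
  linarith

lemma abs_inner_sub_inner_le {u v w : F} {s : ℝ} (hw : ‖w‖ = 1) (h : ‖u - v‖ ≤ s) :
    |inner ℝ u w - inner ℝ v w| ≤ s := by
  rw [← inner_sub_left]
  exact (abs_real_inner_le_norm _ _).trans (by rwa [hw, mul_one])

end

/-- The vectors obtained by applying the `±1`-valued observables and their products of two parties
to the state, for a certificate of the relaxation, with the correlators `E`. -/
lemma InNPALevel.exists_observables {P : Behavior} (hP : InNPALevel P) :
    ∃ (e : EuclideanSpace ℝ NPAIndex) (a b c : Bool → EuclideanSpace ℝ NPAIndex)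
      (ab ac bc : Bool → Bool → EuclideanSpace ℝ NPAIndex) (E : Bool → Bool → Bool → ℝ),
      (‖e‖ = 1 ∧ (∀ x, ‖a x‖ = 1) ∧ (∀ y, ‖b y‖ = 1) ∧ (∀ z, ‖c z‖ = 1) ∧
        (∀ x y, ‖ab x y‖ = 1) ∧ (∀ x z, ‖ac x z‖ = 1) ∧ ∀ y z, ‖bc y z‖ = 1) ∧
      (∀ x y z, inner ℝ (ab x y) (c z) = E x y z) ∧
      (∀ x y z, inner ℝ (ac x z) (b y) = E x y z) ∧
      (∀ x y z, inner ℝ (bc y z) (a x) = E x y z) ∧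
      (∀ x y z, inner ℝ (ac x z) (ab x y) = inner ℝ (b y) (c z)) ∧
      (∀ y z, inner ℝ (bc y z) e = inner ℝ (b y) (c z)) ∧
      (∀ x y z, inner ℝ (a x) e = 2 * aliceMarginal P false x y z - 1) ∧
      ∀ x y, winProb P x y = (1 + (if x && y then -1 else 1) * E x y (thirdSetting x y)) / 2 := by
  obtain ⟨hP0, Γ, hΓ, hΓ1, hΓr, hΓP⟩ := hP
  obtain ⟨V, hV⟩ := exists_gram_of_posSemidef hΓ
  let idxAC (x z : Bool) : NPAIndex := ⟨(some x, none, some z), by simp⟩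
  let idxBC (y z : Bool) : NPAIndex := ⟨(none, some y, some z), by simp⟩
  let e := V idx1
  let a (x : Bool) := (2 : ℝ) • V (idxA x) - e
  let b (y : Bool) := (2 : ℝ) • V (idxB y) - e
  let c (z : Bool) := (2 : ℝ) • V (idxC z) - e
  let ab (x y : Bool) := (4 : ℝ) • V (idxAB x y) - (2 : ℝ) • V (idxA x) - (2 : ℝ) • V (idxB y) + e
  let ac (x z : Bool) := (4 : ℝ) • V (idxAC x z) - (2 : ℝ) • V (idxA x) - (2 : ℝ) • V (idxC z) + e
  let bc (y z : Bool) := (4 : ℝ) • V (idxBC y z) - (2 : ℝ) • V (idxB y) - (2 : ℝ) • V (idxC z) + e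
  -- Viewing the moments as a function of the reduced word makes all identifications between entries
  -- of the certificate definitional after simplification. The value 0 outside the reachable words
  -- is never used.
  obtain ⟨γ, hγ⟩ : ∃ γ : List Bool × List Bool × List Bool → ℝ,
      ∀ u v, inner ℝ (V u) (V v) = γ (reducedProduct u v) := by
    refine ⟨Function.extend (fun p : NPAIndex × NPAIndex => reducedProduct p.1 p.2)
      (fun p => Γ p.1 p.2) 0, fun u v => ?_⟩
    have hf : Function.FactorsThrough (fun p : NPAIndex × NPAIndex => Γ p.1 p.2)
        fun p => reducedProduct p.1 p.2 := fun p p' h => hΓr _ _ _ _ h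
    exact (hV u v).symm.trans (hf.extend_apply 0 (u, v)).symm
  have h1 : γ ([], [], []) = 1 := (hγ idx1 idx1).symm.trans ((hV _ _).symm.trans hΓ1)
  -- Expansion of (2A - 1)(2B - 1)(2C - 1) into moments.
  let E (x y z : Bool) : ℝ := 8 * γ ([x], [y], [z]) - 4 * γ ([x], [y], []) - 4 * γ ([x], [], [z])
    - 4 * γ ([], [y], [z]) + 2 * γ ([x], [], []) + 2 * γ ([], [y], []) + 2 * γ ([], [], [z]) - 1
  have norm_eq_one : ∀ {v : EuclideanSpace ℝ NPAIndex}, inner ℝ v v = 1 → ‖v‖ = 1 := by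
    intro v h
    rw [real_inner_self_eq_norm_sq] at h
    exact (pow_eq_one_iff_of_nonneg (norm_nonneg v) two_ne_zero).1 h
  have ne : ‖e‖ = 1 := norm_eq_one (by simp only [e, hγ]; exact h1)
  have nb : ∀ y, ‖b y‖ = 1 := fun y => norm_eq_one (by
    simp [b, e, inner_sub_left, inner_smul_left,
      inner_sub_right, inner_smul_right, hγ, reducedProduct, reducedPart, idx1, idxB, h1,
      -inner_self_eq_norm_sq_to_K]
    ring)
  have na : ∀ x, ‖a x‖ = 1 := fun y => norm_eq_one (by
    simp [a, e, inner_sub_left, inner_smul_left,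
      inner_sub_right, inner_smul_right, hγ, reducedProduct, reducedPart, idx1, idxA, h1,
      -inner_self_eq_norm_sq_to_K]
    ring)
  have nc : ∀ z, ‖c z‖ = 1 := fun y => norm_eq_one (by
    simp [c, e, inner_sub_left, inner_smul_left,
      inner_sub_right, inner_smul_right, hγ, reducedProduct, reducedPart, idx1, idxC, h1,
      -inner_self_eq_norm_sq_to_K]
    ring)
  have nab : ∀ x y, ‖ab x y‖ = 1 := fun x y => norm_eq_one (by
    simp [ab, e, inner_add_left, inner_sub_left, inner_smul_left, inner_add_right,
      inner_sub_right, inner_smul_right, hγ, reducedProduct, reducedPart, idx1, idxA, idxB, idxAB,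
      h1, -inner_self_eq_norm_sq_to_K]
    ring)
  have nac : ∀ x z, ‖ac x z‖ = 1 := fun x y => norm_eq_one (by
    simp [ac, e, inner_add_left, inner_sub_left, inner_smul_left, inner_add_right,
      inner_sub_right, inner_smul_right, hγ, reducedProduct, reducedPart, idx1, idxA, idxC, idxAC,
      h1, -inner_self_eq_norm_sq_to_K]
    ring)
  have nbc : ∀ y z, ‖bc y z‖ = 1 := fun x y => norm_eq_one (by
    simp [bc, e, inner_add_left, inner_sub_left, inner_smul_left, inner_add_right,
      inner_sub_right, inner_smul_right, hγ, reducedProduct, reducedPart, idx1, idxB, idxC, idxBC,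
      h1, -inner_self_eq_norm_sq_to_K]
    ring)
  have iabc : ∀ x y z, inner ℝ (ab x y) (c z) = E x y z := fun x y z => by
    simp [ab, c, e, E, inner_add_left, inner_sub_left, inner_smul_left,
      inner_sub_right, inner_smul_right, hγ, reducedProduct, reducedPart, idx1, idxA, idxB, idxC,
      idxAB, h1, -inner_self_eq_norm_sq_to_K]
    ring
  have iacb : ∀ x y z, inner ℝ (ac x z) (b y) = E x y z := fun x y z => by
    simp [ac, b, e, E, inner_add_left, inner_sub_left, inner_smul_left,
      inner_sub_right, inner_smul_right, hγ, reducedProduct, reducedPart, idx1, idxA, idxB, idxC,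
      idxAC, h1, -inner_self_eq_norm_sq_to_K]
    ring
  have ibca : ∀ x y z, inner ℝ (bc y z) (a x) = E x y z := fun x y z => by
    simp [bc, a, e, E, inner_add_left, inner_sub_left, inner_smul_left,
      inner_sub_right, inner_smul_right, hγ, reducedProduct, reducedPart, idx1, idxA, idxB, idxC,
      idxBC, h1, -inner_self_eq_norm_sq_to_K]
    ring
  have iacab : ∀ x y z, inner ℝ (ac x z) (ab x y) = inner ℝ (b y) (c z) := fun x y z => by
    simp [ac, ab, b, c, e, inner_add_left, inner_sub_left, inner_smul_left, inner_add_right,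
      inner_sub_right, inner_smul_right, hγ, reducedProduct, reducedPart, idx1, idxA, idxB, idxC,
      idxAC, idxAB, h1, -inner_self_eq_norm_sq_to_K]
    ring
  have ibce : ∀ y z, inner ℝ (bc y z) e = inner ℝ (b y) (c z) := fun y z => by
    simp [bc, b, c, e, inner_add_left, inner_sub_left, inner_smul_left,
      inner_sub_right, inner_smul_right, hγ, reducedProduct, reducedPart, idx1, idxB, idxC,
      idxBC, h1, -inner_self_eq_norm_sq_to_K]
    ring
  have iae : ∀ x y z, inner ℝ (a x) e = 2 * aliceMarginal P false x y z - 1 := fun x y z => by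
    have h := (hΓP x y z).2.1
    rw [hV, hγ] at h
    rw [aliceMarginal, h]
    simp [a, e, inner_sub_left, inner_smul_left, hγ, reducedProduct, reducedPart, idx1, idxA, h1,
      -inner_self_eq_norm_sq_to_K]
  have hE : ∀ x y z, E x y z = ∑ a, ∑ b, ∑ c,
      (if xor (xor a b) c then -1 else 1) * P a b c x y z := by
    intro x y z
    obtain ⟨a0, a1, a2, a3, a4, a5, a6, a7⟩ := hΓP x y z
    simp only [hV, hγ, reducedProduct, reducedPart, idx1, idxA, idxB, idxC, idxAB,
      Fintype.sum_bool] at a0 a1 a2 a3 a4 a5 a6 a7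
    simp only [Fintype.sum_bool, E, ← a1, ← a2, ← a3, ← a4, ← a5, ← a6, ← a7]
    norm_num
    linear_combination a0
  refine ⟨e, a, b, c, ab, ac, bc, E, ⟨ne, na, nb, nc, nab, nac, nbc⟩, iabc, iacb, ibca, iacab, ibce,
    iae, fun x y => ?_⟩
  have h := (hΓP x y (thirdSetting x y)).1
  clear_value E
  rw [hE, winProb]
  simp only [Fintype.sum_bool] at h ⊢
  cases x <;> cases y <;>
  · simp [Wins]
    linear_combination h / 2

/-- The approximate relations run in a cycle: ⟨a, e⟩ ≈ ⟨u, e⟩ = ⟨b, c⟩ ≈ ⟨w, w'⟩ = ⟨v, e⟩ ≈ -⟨a, e⟩.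
Each of the four replacements costs s, hence 2|⟨a, e⟩| ≤ 4s. -/
lemma abs_inner_le_of_chain {F : Type*} [NormedAddCommGroup F] [InnerProductSpace ℝ F]
    {e a u v b c w w' : F} {s : ℝ} (he : ‖e‖ = 1) (hc : ‖c‖ = 1) (hw : ‖w‖ = 1)
    (hau : ‖a - u‖ ≤ s) (hav : ‖a + v‖ ≤ s) (hu : inner ℝ u e = inner ℝ b c)
    (hb : ‖b - w‖ ≤ s) (hcw : ‖c - w'‖ ≤ s) (hv : inner ℝ w w' = inner ℝ v e) :
    |inner ℝ a e| ≤ 2 * s := by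
  have h1 := abs_le.1 (abs_inner_sub_inner_le he hau)
  have h2 := abs_le.1 (abs_inner_sub_inner_le (u := a) (v := -v) (s := s) he (by rwa [sub_neg_eq_add]))
  have h3 := abs_le.1 (abs_inner_sub_inner_le hc hb)
  have h4 := abs_le.1 (abs_inner_sub_inner_le hw hcw)
  rw [inner_neg_left] at h2
  rw [real_inner_comm w c, real_inner_comm w w'] at h4
  rw [abs_le]
  constructor <;> linarith

lemma InNPALevel.abs_two_mul_aliceMarginal_sub_one_le {P : Behavior} (hP : InNPALevel P)
    (x y z : Bool) :
    |2 * aliceMarginal P false x y z - 1| ≤ 8 * √(1 - unbiasedWinProb P) := by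
  obtain ⟨e, a, b, c, ab, ac, bc, E, ⟨ne, na, nb, nc, nab, nac, nbc⟩, iabc, iacb, ibca, iacab, ibce,
    iae, hwE⟩ := hP.exists_observables
  have hδ : 0 ≤ 1 - unbiasedWinProb P := sub_nonneg.2 hP.unbiasedWinProb_le_one
  have hwin := hP.winProb_le_one
  -- Each of the four losing probabilities is at most four times their mean, so every signed
  -- correlator is at least 1 - 8(1 - w) = 1 - s²/2, which makes the corresponding unit vectors
  -- s-close.
  set s : ℝ := 4 * √(1 - unbiasedWinProb P) with hs
  have hs0 : 0 ≤ s := by positivity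
  have hs2 : s ^ 2 = 16 * (1 - unbiasedWinProb P) := by
    rw [hs, mul_pow, Real.sq_sqrt hδ]; norm_num
  have hE : ∀ x y, 1 - s ^ 2 / 2 ≤ (if x && y then -1 else 1) * E x y (thirdSetting x y) := by
    intro x y
    have h := hwE x y
    rw [hs2, unbiasedWinProb]
    simp only [Fintype.sum_bool]
    cases x <;> cases y <;>
      linarith [hwin true true, hwin true false, hwin false true, hwin false false]
  have e001 : 1 - s ^ 2 / 2 ≤ E false false true := by simpa [thirdSetting] using hE false false
  have e010 : 1 - s ^ 2 / 2 ≤ E false true false := by simpa [thirdSetting] using hE false true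
  have e100 : 1 - s ^ 2 / 2 ≤ E true false false := by simpa [thirdSetting] using hE true false
  have e111 : 1 - s ^ 2 / 2 ≤ -E true true true := by simpa [thirdSetting] using hE true true
  have key : |inner ℝ (a x) e| ≤ 2 * s := by
    -- The GHZ contradiction: for A₀ the cycle is A₀ ≈ B₀C₁, B₀ ≈ A₁C₀, C₁ ≈ -A₁B₁, A₀ ≈ B₁C₀; for
    -- A₁ it is A₁ ≈ B₀C₀, B₀ ≈ A₀C₁, C₀ ≈ A₀B₁, A₁ ≈ -B₁C₁. Alice's observable squares to 1 in the
    -- middle of each.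
    cases x
    · refine abs_inner_le_of_chain (u := bc false true) (v := -bc true false) (b := b false)
        (c := c true) (w := ac true false) (w' := -ab true true) ne (nc _) (nac _ _)
        (norm_sub_le_of_inner (na _) (nbc _ _) hs0 ?_) ?_ (ibce _ _)
        (norm_sub_le_of_inner (nb _) (nac _ _) hs0 ?_) ?_ ?_
      · rwa [real_inner_comm, ibca]
      · rw [← sub_eq_add_neg]
        exact norm_sub_le_of_inner (na _) (nbc _ _) hs0 (by rwa [real_inner_comm, ibca])
      · rwa [real_inner_comm, iacb]
      · refine norm_sub_le_of_inner (nc _) (by rw [norm_neg, nab]) hs0 ?_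
        rwa [inner_neg_right, real_inner_comm, iabc]
      · rw [inner_neg_right, inner_neg_left, iacab, ibce]
    · refine abs_inner_le_of_chain (u := bc false false) (v := bc true true) (b := b false)
        (c := c false) (w := ac false true) (w' := ab false true) ne (nc _) (nac _ _)
        (norm_sub_le_of_inner (na _) (nbc _ _) hs0 ?_) ?_ (ibce _ _)
        (norm_sub_le_of_inner (nb _) (nac _ _) hs0 ?_)
        (norm_sub_le_of_inner (nc _) (nab _ _) hs0 ?_) ?_
      · rwa [real_inner_comm, ibca]
      · rw [← sub_neg_eq_add]
        refine norm_sub_le_of_inner (na _) (by rw [norm_neg, nbc]) hs0 ?_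
        rwa [inner_neg_right, real_inner_comm, ibca]
      · rwa [real_inner_comm, iacb]
      · rwa [real_inner_comm, iabc]
      · rw [iacab, ibce]
  rw [← iae x y z]
  linarith

lemma InNPALevel.aliceMarginal_le {P : Behavior} (hP : InNPALevel P) (i x y z : Bool) :
    aliceMarginal P i x y z ≤ 1 / 2 + 4 * √(1 - unbiasedWinProb P) := by
  have h := abs_le.1 (hP.abs_two_mul_aliceMarginal_sub_one_le x y z)
  have h1 := hP.sum_aliceMarginal x y z
  rw [Fintype.sum_bool] at h1
  cases i <;> linarith

/-! ### The function `g` -/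

lemma g_le {ε p d : ℝ} (hd : (1 - p) / (1 / 2 - ε) ^ 2 ≤ d) : g ε p ≤ 4 * √d := by
  rw [g, sub_le_iff_le_add]
  refine Real.sSup_le ?_ (by positivity)
  rintro v ⟨P, hP, hw, i, x, y, rfl⟩
  have h1 := hP.aliceMarginal_le i x y (thirdSetting x y)
  have h2 : √(1 - unbiasedWinProb P) ≤ √d := Real.sqrt_le_sqrt (by linarith)
  linarith

lemma InNPALevel.aliceMarginal_le_g {P : Behavior} (hP : InNPALevel P) {ε p : ℝ}
    (h : 1 - (1 - p) / (1 / 2 - ε) ^ 2 ≤ unbiasedWinProb P) (i x y : Bool) :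
    aliceMarginal P i x y (thirdSetting x y) ≤ 1 / 2 + g ε p := by
  rw [g, add_sub_cancel]
  refine le_csSup ⟨1, ?_⟩ ⟨P, hP, h, i, x, y, rfl⟩
  rintro v ⟨Q, hQ, -, i, x, y, rfl⟩
  exact hQ.aliceMarginal_le_one ..

lemma map_sum_smul {V ι : Type*} [AddCommGroup V] [Module ℝ V] [Fintype ι] (φ : V →ₗ[ℝ] ℝ) (c : ℝ)
    (v : ι → V) : φ (∑ k, c • v k) = c * ∑ k, φ (v k) := by
  rw [← smul_sum, map_smul, map_sum, smul_eq_mul]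

/-- Quantum behaviours can be averaged after aligning their marginals by relabelling. -/
lemma exists_average {N : ℕ} (hN : 0 < N) (P : Fin N → Behavior) (hP : ∀ k, IsQuantum (P k))
    (i x y : Fin N → Bool) :
    ∃ Q : Behavior, InNPALevel Q ∧ unbiasedWinProb Q = (∑ k, unbiasedWinProb (P k)) / N ∧
      aliceMarginal Q false false false (thirdSetting false false) =
        (∑ k, aliceMarginal (P k) (i k) (x k) (y k) (thirdSetting (x k) (y k))) / N := by
  have hN' : (N : ℝ) ≠ 0 := by positivity
  refine ⟨∑ k, (N : ℝ)⁻¹ • relabel (i k) (x k) (y k) (P k),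
    convex_inNPALevel.sum_mem (fun _ _ => by positivity) (by simp [hN'])
      fun k _ => ((hP k).relabel ..).inNPALevel, ?_, ?_⟩
  · refine (map_sum_smul unbiasedWinProbLin _ _).trans ?_
    rw [div_eq_inv_mul]
    exact congrArg _ (sum_congr rfl fun k _ => unbiasedWinProb_relabel ..)
  · refine (map_sum_smul (aliceMarginalLin ..) _ _).trans ?_
    rw [div_eq_inv_mul]
    exact congrArg _ (sum_congr rfl fun k _ => aliceMarginal_relabel ..)

/-- Let D be the defect allowed in `g`. If D ≥ d, the defect of Q is at most D/2, and mixing in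
weight 2d of `constFalse` (defect 1/4, marginal 1) gives a defect at most D/2 + d/2 ≤ D. The mixture
is feasible for `g`, so its marginal is below τ. If D ≤ d, the defect of Q is at most d and the GHZ
bound applies. -/
lemma InNPALevel.aliceMarginal_le_of_g_lt {Q : Behavior} (hQ : InNPALevel Q) {ε p τ d : ℝ}
    (hd : 0 < d) (hd' : d ≤ 1 / 4)
    (hδ : 1 - unbiasedWinProb Q ≤ ((1 - p) / (1 / 2 - ε) ^ 2 + d) / 4)
    (hg : 1 / 2 + g ε p < τ) :
    aliceMarginal Q false false false (thirdSetting false false) ≤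
      max ((τ - 2 * d) / (1 - 2 * d)) (1 / 2 + 4 * √d) := by
  rcases le_total d ((1 - p) / (1 / 2 - ε) ^ 2) with h | h
  · refine le_max_of_le_left ?_
    have hR : InNPALevel ((1 - 2 * d) • Q + (2 * d) • constFalse) :=
      convex_inNPALevel hQ isQuantum_constFalse.inNPALevel (by linarith) (by linarith) (by ring)
    have hw : unbiasedWinProb ((1 - 2 * d) • Q + (2 * d) • constFalse) =
        (1 - 2 * d) * unbiasedWinProb Q + 2 * d * (3 / 4) := by
      rw [← unbiasedWinProb_constFalse]
      change unbiasedWinProbLin _ = _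
      rw [map_add, map_smul, map_smul]
      rfl
    have hm : aliceMarginal ((1 - 2 * d) • Q + (2 * d) • constFalse) false false false
        (thirdSetting false false) =
        (1 - 2 * d) * aliceMarginal Q false false false (thirdSetting false false)
          + 2 * d * 1 := by
      rw [← aliceMarginal_constFalse false false (thirdSetting false false)]
      change aliceMarginalLin _ _ _ _ _ = _
      rw [map_add, map_smul, map_smul]
      rfl
    have hδ0 : 0 ≤ 1 - unbiasedWinProb Q := sub_nonneg.2 hQ.unbiasedWinProb_le_one
    have := hR.aliceMarginal_le_g (ε := ε) (p := p) (by rw [hw]; nlinarith) false false false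
    rw [hm] at this
    rw [le_div_iff₀ (by linarith)]
    linarith
  · refine le_max_of_le_right ((hQ.aliceMarginal_le ..).trans ?_)
    gcongr
    linarith

/-- Uniform bounds for the test: scores close to one pass it, and whenever a score `p` passes it,
behaviours whose average defect is compatible with `p` have marginals bounded away from
`1 / (1 + 2 ε)` on average. -/
lemma exists_uniform_bound {ε : ℝ} (hε : 0 < ε) (hε' : ε < 1 / 2) :
    ∃ d m : ℝ, 0 < d ∧ d ≤ 1 ∧ 0 < m ∧ m * (1 + 2 * ε) < 1 ∧
      (∀ p, 1 - p ≤ d → g ε p < 1 / (1 + 2 * ε) - 1 / 2) ∧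
      ∀ (N : ℕ), 0 < N → ∀ (P : Fin N → Behavior) (i x y : Fin N → Bool) (p : ℝ),
        (∀ k, IsQuantum (P k)) → g ε p < 1 / (1 + 2 * ε) - 1 / 2 →
        ∑ k, 4 * (1 / 2 - ε) ^ 2 * (1 - unbiasedWinProb (P k)) ≤ N * (1 - p + d) →
        ∑ k, aliceMarginal (P k) (i k) (x k) (y k) (thirdSetting (x k) (y k)) ≤ N * m := by
  set τ := 1 / (1 + 2 * ε) with hτ
  have hτ1 : τ < 1 := by rw [hτ, div_lt_one] <;> linarith
  have hτ2 : 1 / 2 < τ := by rw [hτ]; apply one_div_lt_one_div_of_lt <;> linarith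
  have hκ : 0 < (1 / 2 - ε) ^ 2 := pow_pos (by linarith) 2
  have hκ1 : (1 / 2 - ε) ^ 2 ≤ 1 := by nlinarith
  -- Chosen so that 1/2 + 4√d is the midpoint of 1/2 and τ.
  set d := ((τ - 1 / 2) / 8) ^ 2 with hd
  have hd0 : 0 < d := pow_pos (by linarith) 2
  have hd1 : d ≤ 1 / 4 := by nlinarith
  have hsd : √d = (τ - 1 / 2) / 8 := Real.sqrt_sq (by linarith)
  -- The factor (1/2 - ε)² makes a deviation of the score by this amount change the defect allowed
  -- in `g` by exactly d. The first entry of the maximum is below τ because τ < 1.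
  refine ⟨(1 / 2 - ε) ^ 2 * d, max ((τ - 2 * d) / (1 - 2 * d)) (1 / 2 + 4 * √d), by positivity,
    by nlinarith, lt_max_of_lt_right (by positivity), ?_, fun p hp => ?_,
    fun N hN P i x y p hP hg hδ => ?_⟩
  · rw [← lt_div_iff₀ (by linarith), ← hτ]
    refine max_lt ?_ (by linarith)
    rw [div_lt_iff₀ (by linarith)]
    nlinarith
  · have h := g_le (ε := ε) (p := p) (d := d) (by rw [div_le_iff₀ hκ]; linarith)
    linarith
  · have hN' : (0 : ℝ) < N := by positivity
    obtain ⟨Q, hQ, hQw, hQm⟩ := exists_average hN P hP i x y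
    have h := hQ.aliceMarginal_le_of_g_lt (ε := ε) (p := p) (τ := τ) hd0 hd1 ?_
      (by linarith)
    · rwa [hQm, div_le_iff₀' hN'] at h
    · rw [← mul_sum, sum_sub_distrib] at hδ
      simp only [sum_const, card_univ, Fintype.card_fin, nsmul_eq_mul, mul_one] at hδ
      have hw : ∑ k, unbiasedWinProb (P k) = N * unbiasedWinProb Q := by
        rw [hQw, mul_div_cancel₀ _ hN'.ne']
      rw [hw] at hδ
      have h2 : 4 * (1 / 2 - ε) ^ 2 * (1 - unbiasedWinProb Q) ≤ 1 - p + (1 / 2 - ε) ^ 2 * d := by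
        refine le_of_mul_le_mul_left ?_ hN'
        linarith
      rw [le_div_iff₀ (by norm_num), ← sub_le_iff_le_add, le_div_iff₀ hκ]
      linarith

/-! ### Santha–Vazirani sources -/

section Source

variable {n : ℕ}

/-- Probability that the first `k` bits are those of `w`. -/
def prefixProb (μ : PMF (Fin n → Bool)) (k : ℕ) (w : ℕ → Bool) : ℝ :=
  prob (fun v => (μ v).toReal) {v | ∀ j : Fin n, (j : ℕ) < k → v j = w j}

lemma prob_mono {Ω : Type*} [Fintype Ω] {m : Ω → ℝ} (hm : ∀ ω, 0 ≤ m ω) {A B : Set Ω}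
    (h : A ⊆ B) : prob m A ≤ prob m B := by
  classical
  refine sum_le_sum fun ω _ => ?_
  by_cases hA : ω ∈ A
  · rw [if_pos hA, if_pos (h hA)]
  · rw [if_neg hA]
    split_ifs
    · exact hm ω
    · exact le_rfl

lemma prob_nonneg {Ω : Type*} [Fintype Ω] {m : Ω → ℝ} (hm : ∀ ω, 0 ≤ m ω) (A : Set Ω) :
    0 ≤ prob m A :=
  sum_nonneg fun ω _ => by
    split_ifs
    · exact hm ω
    · exact le_rfl

lemma prob_inter_add_inter_compl {Ω : Type*} [Fintype Ω] (m : Ω → ℝ) (A B : Set Ω) :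
    prob m (A ∩ B) + prob m (Aᶜ ∩ B) = prob m B := by
  classical
  rw [prob, prob, prob, ← sum_add_distrib]
  refine sum_congr rfl fun ω _ => ?_
  by_cases hA : ω ∈ A <;> simp [hA]

lemma sum_toReal_pmf {Ω : Type*} [Fintype Ω] (μ : PMF Ω) : ∑ ω, (μ ω).toReal = 1 := by
  rw [← ENNReal.toReal_sum fun ω _ => μ.apply_ne_top ω, ← tsum_fintype (L := .unconditional Ω),
    μ.tsum_coe, ENNReal.toReal_one]

variable (μ : PMF (Fin n → Bool))

lemma prefixProb_nonneg (k : ℕ) (w : ℕ → Bool) : 0 ≤ prefixProb μ k w :=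
  prob_nonneg (fun _ => ENNReal.toReal_nonneg) _

lemma prefixProb_congr {k : ℕ} {w w' : ℕ → Bool} (h : ∀ j < k, w j = w' j) :
    prefixProb μ k w = prefixProb μ k w' := by
  unfold prefixProb
  congr 1
  ext v
  exact forall_congr' fun j => forall_congr' fun hj => by rw [h j hj]

lemma prefixProb_zero (w : ℕ → Bool) : prefixProb μ 0 w = 1 := by
  simp [prefixProb, prob, sum_toReal_pmf]

lemma prefixProb_top (v : Fin n → Bool) {w : ℕ → Bool} (h : ∀ j : Fin n, w j = v j) :
    prefixProb μ n w = (μ v).toReal := by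
  classical
  have : {u : Fin n → Bool | ∀ j : Fin n, (j : ℕ) < n → u j = w j} = {v} := by
    ext u
    simp [h, funext_iff]
  rw [prefixProb, this, prob]
  simp

lemma prefixProb_update {k : ℕ} (hk : k < n) (w : ℕ → Bool) (b : Bool) :
    prefixProb μ (k + 1) (Function.update w k b) = prob (fun v => (μ v).toReal)
      ({v | v ⟨k, hk⟩ = b} ∩ {v | ∀ j : Fin n, (j : ℕ) < k → v j = w j}) := by
  unfold prefixProb
  congr 1
  ext v
  refine ⟨fun hv => ⟨?_, fun j hj => ?_⟩, fun hv j hj => ?_⟩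
  · simpa using hv ⟨k, hk⟩ (Nat.lt_succ_self k)
  · simpa [hj.ne] using hv j (by omega)
  · rcases Nat.lt_succ_iff_lt_or_eq.1 hj with hj | hj
    · simpa [hj.ne] using hv.2 j hj
    · obtain rfl : j = ⟨k, hk⟩ := Fin.ext hj
      simpa using hv.1

lemma prefixProb_succ_add {k : ℕ} (hk : k < n) (w : ℕ → Bool) :
    prefixProb μ (k + 1) (Function.update w k false) +
      prefixProb μ (k + 1) (Function.update w k true) = prefixProb μ k w := by
  have hc : {v : Fin n → Bool | v ⟨k, hk⟩ = true} = {v | v ⟨k, hk⟩ = false}ᶜ := by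
    ext v
    simp
  rw [prefixProb_update μ hk, prefixProb_update μ hk, hc]
  exact prob_inter_add_inter_compl ..

variable {μ}

lemma prefixProb_update_false_mem {ε : ℝ} (hμ : IsSanthaVazirani ε μ) {k : ℕ} (hk : k < n)
    (w : ℕ → Bool) :
    prefixProb μ (k + 1) (Function.update w k false) ∈
      Set.Icc ((1 / 2 - ε) * prefixProb μ k w) ((1 / 2 + ε) * prefixProb μ k w) := by
  rcases (prefixProb_nonneg μ k w).eq_or_lt with h0 | h0
  · have h := prefixProb_succ_add μ hk w
    have h1 := prefixProb_nonneg μ (k + 1) (Function.update w k false)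
    have h2 := prefixProb_nonneg μ (k + 1) (Function.update w k true)
    rw [← h0] at h ⊢
    constructor <;> linarith
  · have h := hμ ⟨k, hk⟩ (fun j => w j) h0
    rw [prefixProb_update μ hk]
    exact ⟨(le_div_iff₀ h0).1 h.1, (div_le_iff₀ h0).1 h.2⟩

lemma prefixProb_succ_mem {ε : ℝ} (hμ : IsSanthaVazirani ε μ) {k : ℕ} (hk : k < n)
    (w : ℕ → Bool) :
    prefixProb μ (k + 1) w ∈
      Set.Icc ((1 / 2 - ε) * prefixProb μ k w) ((1 / 2 + ε) * prefixProb μ k w) := by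
  have h1 := prefixProb_update_false_mem hμ hk w
  have h2 := prefixProb_succ_add μ hk w
  rw [Set.mem_Icc] at h1 ⊢
  cases h : w k
  · rwa [← h, Function.update_eq_self] at h1
  · rw [← h, Function.update_eq_self] at h2
    constructor <;> linarith [h1.1, h1.2]

lemma prefixProb_add_le {ε : ℝ} (hε : 0 < ε) (hμ : IsSanthaVazirani ε μ) (w : ℕ → Bool) (k : ℕ) :
    ∀ l, k + l ≤ n → prefixProb μ (k + l) w ≤ (1 / 2 + ε) ^ l * prefixProb μ k w
  | 0, _ => by simp
  | l + 1, h => by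
    refine (prefixProb_succ_mem hμ (by omega : k + l < n) w).2.trans ?_
    rw [pow_succ', mul_assoc]
    exact mul_le_mul_of_nonneg_left (prefixProb_add_le hε hμ w k l (by omega)) (by linarith)

end Source

/-! ### Sums over transcripts -/

/-- Rounds as tuples of bits. -/
def roundEquiv : Round ≃ Bool × Bool × Bool × Bool × Bool where
  toFun r := (r.x, r.y, r.a, r.b, r.c)
  invFun p := ⟨p.1, p.2.1, p.2.2.1, p.2.2.2.1, p.2.2.2.2⟩

instance : Fintype Round := Fintype.ofEquiv _ roundEquiv.symm

lemma sum_round (f : Round → ℝ) : ∑ r, f r = ∑ x, ∑ y, ∑ a, ∑ b, ∑ c, f ⟨x, y, a, b, c⟩ := by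
  rw [← roundEquiv.symm.sum_comp f]
  simp only [Fintype.sum_prod_type]
  rfl

/-- Supermartingale induction on the length: summing out the last round costs at most a factor C. No
sign condition is placed on Φ, so the same induction also yields lower bounds through -Φ. -/
lemma sum_le_pow_of_sum_snoc_le {α : Type*} [Fintype α] (Φ : ∀ k, (Fin k → α) → ℝ) {C : ℝ}
    (hC : 0 ≤ C) (n : ℕ)
    (h : ∀ k < n, ∀ t, ∑ r, Φ (k + 1) (Fin.snoc (α := fun _ => α) t r) ≤ C * Φ k t) :
    ∑ t, Φ n t ≤ C ^ n * Φ 0 Fin.elim0 := by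
  induction n with
  | zero => simp [Subsingleton.elim default (Fin.elim0 : Fin 0 → α)]
  | succ n ih =>
    have h1 := ih fun k hk => h k (hk.trans (Nat.lt_succ_self n))
    rw [← (Fin.snocEquiv fun _ => α).sum_comp, Fintype.sum_prod_type, sum_comm]
    calc ∑ t, ∑ r, Φ (n + 1) (Fin.snoc (α := fun _ => α) t r)
        ≤ ∑ t, C * Φ n t := sum_le_sum fun t _ => h n (Nat.lt_succ_self n) t
      _ = C * ∑ t, Φ n t := by rw [mul_sum]
      _ ≤ C * (C ^ n * Φ 0 Fin.elim0) := mul_le_mul_of_nonneg_left h1 hC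
      _ = C ^ (n + 1) * Φ 0 Fin.elim0 := by ring

/-- A transcript extended by one iteration. -/
abbrev snocRound {k : ℕ} (t : Transcript k) (r : Round) : Transcript (k + 1) :=
  Fin.snoc (α := fun _ => Round) t r

lemma history_snoc_castSucc {k : ℕ} (t : Transcript k) (r : Round) (i : Fin k) :
    history (snocRound t r) i.castSucc = history t i := by
  unfold history
  refine congrArg List.ofFn (funext fun j => ?_)
  exact Fin.snoc_castSucc (α := fun _ => Round) r t ⟨j, j.isLt.trans i.isLt⟩

lemma history_snoc_last {k : ℕ} (t : Transcript k) (r : Round) :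
    history (snocRound t r) (Fin.last k) = List.ofFn t := by
  unfold history
  refine congrArg List.ofFn (funext fun j => ?_)
  exact Fin.snoc_castSucc (α := fun _ => Round) r t j

lemma prod_history_snoc {M : Type*} [CommMonoid M] {k : ℕ} (K : ℕ → List Round → Round → M)
    (t : Transcript k) (r : Round) :
    ∏ i : Fin (k + 1), K i (history (snocRound t r) i) (snocRound t r i) =
      (∏ i : Fin k, K i (history t i) (t i)) * K k (List.ofFn t) r := by
  rw [Fin.prod_univ_castSucc, history_snoc_last]
  simp only [history_snoc_castSucc, snocRound, Fin.snoc_castSucc, Fin.snoc_last, Fin.val_castSucc,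
    Fin.val_last]

lemma sum_prod_history_le (K : ℕ → List Round → Round → ℝ) (n : ℕ)
    (hK : ∀ k l r, 0 ≤ K k l r) (h : ∀ k < n, ∀ l, ∑ r, K k l r ≤ 1) :
    ∑ t : Transcript n, ∏ i : Fin n, K i (history t i) (t i) ≤ 1 := by
  have := sum_le_pow_of_sum_snoc_le
    (fun k (t : Transcript k) => ∏ i : Fin k, K i (history t i) (t i)) zero_le_one n
    fun k hk t => by
      simp only [prod_history_snoc]
      rw [← mul_sum, one_mul]
      exact mul_le_of_le_one_right (prod_nonneg fun _ _ => hK ..) (h k hk _)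
  simpa using this

lemma one_le_sum_prod_history (K : ℕ → List Round → Round → ℝ) (n : ℕ)
    (h : ∀ k < n, ∀ l, ∑ r, K k l r = 1) :
    1 ≤ ∑ t : Transcript n, ∏ i : Fin n, K i (history t i) (t i) := by
  have := sum_le_pow_of_sum_snoc_le
    (fun k (t : Transcript k) => -∏ i : Fin k, K i (history t i) (t i)) zero_le_one n
    fun k hk t => by
      simp only [prod_history_snoc]
      rw [sum_neg_distrib, ← mul_sum, one_mul, h k hk, mul_one]
  simpa using this

/-- Probability of the outcomes of a round given its settings and the history. -/
def roundProb (β : List Round → Behavior) (l : List Round) (r : Round) : ℝ :=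
  β l r.a r.b r.c r.x r.y (thirdSetting r.x r.y)

/-- Probability of all outcomes of a transcript given its settings. -/
def boxWeight (β : List Round → Behavior) {k : ℕ} (t : Transcript k) : ℝ :=
  ∏ i, roundProb β (history t i) (t i)

lemma boxWeight_snoc (β : List Round → Behavior) {k : ℕ} (t : Transcript k) (r : Round) :
    boxWeight β (snocRound t r) = boxWeight β t * roundProb β (List.ofFn t) r :=
  prod_history_snoc (fun _ => roundProb β) t r

/-- The settings of a transcript, in the order in which the source produces them. -/
def settings {k : ℕ} (t : Transcript k) (j : ℕ) : Bool :=
  if h : j / 2 < k then if j % 2 = 0 then (t ⟨j / 2, h⟩).x else (t ⟨j / 2, h⟩).y else false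

lemma settings_snoc {k : ℕ} (t : Transcript k) (r : Round) {j : ℕ} (hj : j < 2 * k + 2) :
    settings (snocRound t r) j =
      Function.update (Function.update (settings t) (2 * k) r.x) (2 * k + 1) r.y j := by
  rcases lt_or_ge j (2 * k) with h | h
  · rw [Function.update_of_ne (by omega), Function.update_of_ne (by omega)]
    have h1 : j / 2 < k := by omega
    have h2 : snocRound t r ⟨j / 2, by omega⟩ = t ⟨j / 2, h1⟩ :=
      Fin.snoc_castSucc (α := fun _ => Round) r t ⟨j / 2, h1⟩
    simp only [settings, h1, show j / 2 < k + 1 by omega, dif_pos, h2]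
  · have h1 : ∀ h : j / 2 < k + 1, (⟨j / 2, h⟩ : Fin (k + 1)) = Fin.last k := fun h =>
      Fin.ext (show j / 2 = k by omega)
    rw [settings, dif_pos (show j / 2 < k + 1 by omega), h1,
      show snocRound t r (Fin.last k) = r from Fin.snoc_last ..]
    obtain rfl | rfl : j = 2 * k ∨ j = 2 * k + 1 := by omega
    · rw [Function.update_of_ne (by omega), Function.update_self, if_pos (by omega)]
    · rw [Function.update_self, if_neg (by omega)]

/-! ### Concentration of the number of lost rounds -/

/-- A lower bound on the probability of losing a round for a Santha–Vazirani source, minus the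
indicator of losing it. -/
def excess (ε : ℝ) (β : List Round → Behavior) (l : List Round) (r : Round) : ℝ :=
  4 * (1 / 2 - ε) ^ 2 * (1 - unbiasedWinProb (β l)) - if Wins r.x r.y r.a r.b r.c then 0 else 1

lemma exp_mul_le {s z : ℝ} (hs : 0 ≤ s) (hs1 : s ≤ 1) (hz : |z| ≤ 1) :
    Real.exp (s * z) ≤ 1 + s ^ 2 + s * z := by
  have h1 : |s * z| ≤ 1 := by
    rw [abs_mul, abs_of_nonneg hs]
    exact mul_le_one₀ hs1 (abs_nonneg z) hz
  have h2 := (abs_le.1 (Real.abs_exp_sub_one_sub_id_le h1)).2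
  have h3 : (s * z) ^ 2 ≤ s ^ 2 := by
    rw [mul_pow]
    exact mul_le_of_le_one_right (sq_nonneg s) ((sq_le_one_iff_abs_le_one z).2 hz)
  linarith

section

variable {n : ℕ} {μ : PMF (Fin n → Bool)} {ε : ℝ} {β : List Round → Behavior}

lemma sum_roundProb_mul_exp_le (hβ : ∀ l, InNPALevel (β l)) (hε : 0 < ε) (hε' : ε < 1 / 2) {s : ℝ}
    (hs : 0 ≤ s) (hs1 : s ≤ 1) (l : List Round) (x y : Bool) :
    ∑ a, ∑ b, ∑ c, roundProb β l ⟨x, y, a, b, c⟩ * Real.exp (s * excess ε β l ⟨x, y, a, b, c⟩) ≤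
      1 + s ^ 2 + s * (4 * (1 / 2 - ε) ^ 2 * (1 - unbiasedWinProb (β l)) -
        (1 - winProb (β l) x y)) := by
  have hw0 := (hβ l).unbiasedWinProb_nonneg
  have hw1 := (hβ l).unbiasedWinProb_le_one
  set D := 4 * (1 / 2 - ε) ^ 2 * (1 - unbiasedWinProb (β l)) with hD
  have hκ : 4 * (1 / 2 - ε) ^ 2 ≤ 1 := by nlinarith
  have hD0 : 0 ≤ D := mul_nonneg (by positivity) (by linarith)
  have hD1 : D ≤ 1 := mul_le_one₀ hκ (by linarith) (by linarith)
  calc _ ≤ ∑ a, ∑ b, ∑ c, (β l a b c x y (thirdSetting x y) * (1 + s ^ 2 + s * (D - 1)) +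
        s * if Wins x y a b c then β l a b c x y (thirdSetting x y) else 0) := by
        refine sum_le_sum fun a _ => sum_le_sum fun b _ => sum_le_sum fun c _ => ?_
        have h0 := (hβ l).1 a b c x y (thirdSetting x y)
        have h1 := exp_mul_le (z := excess ε β l ⟨x, y, a, b, c⟩) hs hs1 (by
          rw [excess, ← hD, abs_le]
          split_ifs <;> constructor <;> linarith)
        refine (mul_le_mul_of_nonneg_left h1 h0).trans_eq ?_
        rw [excess, ← hD]
        dsimp only
        split_ifs <;> ring
    _ = (∑ a, aliceMarginal (β l) a x y (thirdSetting x y)) * (1 + s ^ 2 + s * (D - 1)) +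
        s * winProb (β l) x y := by
        simp only [sum_add_distrib, ← mul_sum, ← sum_mul, winProb, aliceMarginal]
    _ = _ := by
        rw [(hβ l).sum_aliceMarginal]
        ring

/-- Per round the exponential moment grows by at most 1 + s². By `exp_mul_le` it is enough that the
conditional mean of the excess is nonpositive, which holds because the source gives each of the four
pairs of settings conditional weight at least (1/2 - ε)². -/
lemma sum_exp_excess_le (hμ : IsSanthaVazirani ε μ) (hβ : ∀ l, InNPALevel (β l)) (hε : 0 < ε)
    (hε' : ε < 1 / 2) {s : ℝ} (hs : 0 ≤ s) (hs1 : s ≤ 1) {N : ℕ} (hN : 2 * N ≤ n) :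
    ∑ t : Transcript N, prefixProb μ (2 * N) (settings t) * boxWeight β t *
      Real.exp (s * ∑ i, excess ε β (history t i) (t i)) ≤ (1 + s ^ 2) ^ N := by
  have hexp : ∀ {k : ℕ} (t : Transcript k), Real.exp (s * ∑ i, excess ε β (history t i) (t i)) =
      ∏ i, Real.exp (s * excess ε β (history t i) (t i)) := fun t => by
    rw [mul_sum, Real.exp_sum]
  simp only [hexp]
  refine (sum_le_pow_of_sum_snoc_le (fun k (t : Transcript k) => prefixProb μ (2 * k) (settings t) *
    boxWeight β t * ∏ i, Real.exp (s * excess ε β (history t i) (t i)))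
    (by positivity : 0 ≤ 1 + s ^ 2) N fun k hk t => ?_).trans ?_
  · have hbw : 0 ≤ boxWeight β t := prod_nonneg fun _ _ => (hβ _).1 ..
    set l := List.ofFn t with hl
    set W := prefixProb μ (2 * k) (settings t) with hW
    let V (x y : Bool) : ℝ := prefixProb μ (2 * k + 1 + 1)
      (Function.update (Function.update (settings t) (2 * k) x) (2 * k + 1) y)
    have hVsum : ∑ x, ∑ y, V x y = W := by
      simp only [Fintype.sum_bool]
      have h1 := prefixProb_succ_add μ (by omega : 2 * k < n) (settings t)
      have h2 := prefixProb_succ_add μ (by omega : 2 * k + 1 < n)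
        (Function.update (settings t) (2 * k) true)
      have h3 := prefixProb_succ_add μ (by omega : 2 * k + 1 < n)
        (Function.update (settings t) (2 * k) false)
      simp only [V]
      linarith
    have hVge : ∀ x y, (1 / 2 - ε) ^ 2 * W ≤ V x y := by
      intro x y
      have h1 := (prefixProb_succ_mem hμ (by omega : 2 * k < n)
        (Function.update (Function.update (settings t) (2 * k) x) (2 * k + 1) y)).1
      have h2 := (prefixProb_succ_mem hμ (by omega : 2 * k + 1 < n)
        (Function.update (Function.update (settings t) (2 * k) x) (2 * k + 1) y)).1
      rw [prefixProb_congr μ (w' := settings t) fun j hj => by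
        rw [Function.update_of_ne (by omega), Function.update_of_ne (by omega)]] at h1
      rw [pow_two, mul_assoc]
      exact (mul_le_mul_of_nonneg_left h1 (by linarith)).trans h2
    have hV : ∀ r, prefixProb μ (2 * (k + 1)) (settings (snocRound t r)) = V r.x r.y := fun r =>
      prefixProb_congr μ fun j hj => settings_snoc t r hj
    have hP := prod_history_snoc (fun _ l r => Real.exp (s * excess ε β l r)) t
    have hfac : ∀ r, prefixProb μ (2 * (k + 1)) (settings (snocRound t r)) *
        boxWeight β (snocRound t r) *
        ∏ i, Real.exp (s * excess ε β (history (snocRound t r) i) (snocRound t r i)) =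
        boxWeight β t * (∏ i, Real.exp (s * excess ε β (history t i) (t i))) *
          (V r.x r.y * (roundProb β l r * Real.exp (s * excess ε β l r))) := by
      intro r
      rw [hV, boxWeight_snoc, hP]
      ring
    have key : ∑ r : Round, V r.x r.y * (roundProb β l r * Real.exp (s * excess ε β l r)) ≤
        (1 + s ^ 2) * W := by
      rw [sum_round]
      simp only [← mul_sum]
      set D := 4 * (1 / 2 - ε) ^ 2 * (1 - unbiasedWinProb (β l)) with hD
      calc _ ≤ ∑ x, ∑ y, (V x y * (1 + s ^ 2 + s * D) -
            s * ((1 / 2 - ε) ^ 2 * W * (1 - winProb (β l) x y))) := by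
            refine sum_le_sum fun x _ => sum_le_sum fun y _ => ?_
            have hV0 : 0 ≤ V x y := prefixProb_nonneg μ _ _
            have h1 := mul_le_mul_of_nonneg_left
              (sum_roundProb_mul_exp_le hβ hε hε' hs hs1 l x y) hV0
            have h2 := mul_le_mul_of_nonneg_left (mul_le_mul_of_nonneg_right (hVge x y)
              (sub_nonneg.2 ((hβ l).winProb_le_one x y))) hs
            refine h1.trans ?_
            rw [← hD]
            linarith
        _ = (1 + s ^ 2 + s * D) * (∑ x, ∑ y, V x y) -
            s * ((1 / 2 - ε) ^ 2 * W * (4 * (1 - unbiasedWinProb (β l)))) := by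
            simp only [unbiasedWinProb, Fintype.sum_bool]
            ring
        _ = (1 + s ^ 2) * W := by
            rw [hVsum, hD]
            ring
    simp only [hfac]
    rw [← mul_sum]
    refine (mul_le_mul_of_nonneg_left key (mul_nonneg hbw (prod_nonneg fun _ _ =>
      (Real.exp_pos _).le))).trans_eq ?_
    ring
  · simp [prefixProb_zero, boxWeight]

/-- Markov's inequality for the exponential moment; s = c/2 minimizes s² - sc, with value -c²/4. -/
lemma sum_excess_ge_le (hμ : IsSanthaVazirani ε μ) (hβ : ∀ l, InNPALevel (β l)) (hε : 0 < ε)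
    (hε' : ε < 1 / 2) {c : ℝ} (hc : 0 ≤ c) (hc1 : c ≤ 1) {N : ℕ} (hN : 2 * N ≤ n) :
    (∑ t : Transcript N, if N * c ≤ ∑ i, excess ε β (history t i) (t i) then
      prefixProb μ (2 * N) (settings t) * boxWeight β t else 0) ≤ Real.exp (-(c ^ 2 / 4)) ^ N := by
  have h := sum_exp_excess_le hμ hβ hε hε' (by linarith : 0 ≤ c / 2) (by linarith) hN
  have h1 : (1 + (c / 2) ^ 2) ^ N ≤ Real.exp ((c / 2) ^ 2) ^ N :=
    pow_le_pow_left₀ (by positivity) (by linarith [Real.add_one_le_exp ((c / 2) ^ 2)]) N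
  have h2 : (∑ t : Transcript N, if N * c ≤ ∑ i, excess ε β (history t i) (t i) then
      prefixProb μ (2 * N) (settings t) * boxWeight β t else 0) * Real.exp (c / 2 * (N * c)) ≤
      ∑ t : Transcript N, prefixProb μ (2 * N) (settings t) * boxWeight β t *
        Real.exp (c / 2 * ∑ i, excess ε β (history t i) (t i)) := by
    rw [sum_mul]
    refine sum_le_sum fun t _ => ?_
    have hbw : 0 ≤ prefixProb μ (2 * N) (settings t) * boxWeight β t :=
      mul_nonneg (prefixProb_nonneg μ _ _) (prod_nonneg fun _ _ => (hβ _).1 ..)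
    split_ifs with ht
    · gcongr
    · rw [zero_mul]
      positivity
  rw [← le_div_iff₀ (Real.exp_pos _)] at h2
  refine h2.trans ((div_le_div_of_nonneg_right (h.trans h1) (Real.exp_pos _).le).trans_eq ?_)
  rw [← Real.exp_nat_mul, ← Real.exp_nat_mul, ← Real.exp_sub]
  congr 1
  ring

end

/-! ### The law of the protocol -/

/-- The settings of the transcript are those given by the source bits. -/
def Matches {N : ℕ} (v : Fin (3 * N) → Bool) (t : Transcript N) : Prop :=
  ∀ i, (t i).x = xBit v i ∧ (t i).y = yBit v i

open Classical in
lemma sum_outcome {N : ℕ} (f : (Fin (3 * N) → Bool) → Transcript N → ℝ) :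
    ∑ ω : Outcome N, f ω.1 (transcript ω) = ∑ v, ∑ t, if Matches v t then f v t else 0 := by
  rw [Fintype.sum_prod_type]
  refine sum_congr rfl fun v _ => ?_
  rw [← sum_filter]
  refine sum_nbij' (fun o => transcript (v, o)) (fun t i => ((t i).a, (t i).b, (t i).c))
    (fun o _ => ?_) (fun _ _ => mem_univ _) (fun _ _ => rfl) (fun t ht => ?_) (fun _ _ => rfl)
  · exact mem_filter.2 ⟨mem_univ _, fun i => ⟨rfl, rfl⟩⟩
  · funext i
    have h := (mem_filter.1 ht).2 i
    simp only [transcript, ← h.1, ← h.2]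

lemma matches_iff {N : ℕ} (v : Fin (3 * N) → Bool) (t : Transcript N) :
    Matches v t ↔ ∀ j : Fin (3 * N), (j : ℕ) < 2 * N → v j = settings t j := by
  constructor
  · intro h j hj
    have h1 : (j : ℕ) / 2 < N := by omega
    have h2 := h ⟨j / 2, h1⟩
    rw [settings, dif_pos h1]
    split_ifs with h3
    · rw [h2.1, xBit]
      exact congrArg v (Fin.ext (by dsimp only; omega))
    · rw [h2.2, yBit]
      exact congrArg v (Fin.ext (by dsimp only; omega))
  · intro h i
    constructor
    · have h1 := h ⟨2 * i, by omega⟩ (by dsimp only; omega)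
      rw [xBit, h1, settings, dif_pos (by dsimp only; omega), if_pos (by dsimp only; omega)]
      exact congrArg (fun i => (t i).x) (Fin.ext (by dsimp only; omega))
    · have h1 := h ⟨2 * i + 1, by omega⟩ (by dsimp only; omega)
      rw [yBit, h1, settings, dif_pos (by dsimp only; omega), if_neg (by dsimp only; omega)]
      exact congrArg (fun i => (t i).y) (Fin.ext (by dsimp only; omega))

section

variable {ε : ℝ} {E : Type*} {N : ℕ} (D : Devices ε E N) (e : E)

lemma Devices.law_eq (ω : Outcome N) :
    D.law e ω = (D.source e ω.1).toReal * boxWeight (D.box e) (transcript ω) := rfl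

lemma Devices.inNPALevel (l : List Round) : InNPALevel (D.box e l) :=
  (D.box_quantum e l).inNPALevel

lemma roundProb_nonneg {β : List Round → Behavior} (hβ : ∀ l, InNPALevel (β l)) (l : List Round)
    (r : Round) : 0 ≤ roundProb β l r :=
  (hβ l).1 ..

lemma boxWeight_nonneg {β : List Round → Behavior} (hβ : ∀ l, InNPALevel (β l)) (t : Transcript N) :
    0 ≤ boxWeight β t :=
  prod_nonneg fun _ _ => roundProb_nonneg hβ ..

lemma Devices.law_nonneg (ω : Outcome N) : 0 ≤ D.law e ω := by
  rw [D.law_eq]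
  exact mul_nonneg ENNReal.toReal_nonneg (boxWeight_nonneg (D.inNPALevel e) _)

open Classical in
lemma Devices.prob_transcript (S : Set (Transcript N)) :
    prob (D.law e) {ω | transcript ω ∈ S} = ∑ t : Transcript N, if t ∈ S then
      prefixProb (D.source e) (2 * N) (settings t) * boxWeight (D.box e) t else 0 := by
  have h := sum_outcome fun v (t : Transcript N) =>
    if t ∈ S then (D.source e v).toReal * boxWeight (D.box e) t else 0
  refine Eq.trans ?_ (h.trans ?_)
  · exact sum_congr rfl fun ω _ => if_congr Iff.rfl (D.law_eq e ω) rfl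
  · rw [sum_comm]
    refine sum_congr rfl fun t _ => ?_
    split_ifs with ht
    · rw [prefixProb, prob, sum_mul]
      refine sum_congr rfl fun v _ => ?_
      rw [ite_mul, zero_mul]
      by_cases hv : Matches v t
      · rw [if_pos hv]
        exact (if_pos ((matches_iff v t).1 hv)).symm
      · rw [if_neg hv]
        exact (if_neg (mt (matches_iff v t).2 hv)).symm
    · simp

/-! ### Sums over transcripts with given settings -/

variable {β : List Round → Behavior}

/-- The kernel `K` restricted to the settings given by the source bits. -/
def matchKernel (v : Fin (3 * N) → Bool) (K : ℕ → List Round → Round → ℝ) (k : ℕ) (l : List Round)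
    (r : Round) : ℝ :=
  if hk : k < N then if r.x = xBit v ⟨k, hk⟩ ∧ r.y = yBit v ⟨k, hk⟩ then K k l r else 0 else 0

open Classical in
lemma prod_matchKernel (v : Fin (3 * N) → Bool) (K : ℕ → List Round → Round → ℝ)
    (t : Transcript N) : ∏ i : Fin N, matchKernel v K i (history t i) (t i) =
      if Matches v t then ∏ i : Fin N, K i (history t i) (t i) else 0 := by
  simp only [matchKernel, Fin.is_lt, dif_pos]
  rw [prod_ite_zero]
  by_cases hv : Matches v t
  · rw [if_pos hv, if_pos fun i _ => hv i]
  · rw [if_neg hv, if_neg fun h => hv fun i => h i (mem_univ i)]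

lemma sum_matchKernel (v : Fin (3 * N) → Bool) (K : ℕ → List Round → Round → ℝ) {k : ℕ}
    (hk : k < N) (l : List Round) : ∑ r, matchKernel v K k l r =
      ∑ a, ∑ b, ∑ c, K k l ⟨xBit v ⟨k, hk⟩, yBit v ⟨k, hk⟩, a, b, c⟩ := by
  simp only [matchKernel, hk, dif_pos, sum_round]
  rw [sum_eq_single (xBit v ⟨k, hk⟩) (fun x _ hx => by simp [hx]) (by simp),
    sum_eq_single (yBit v ⟨k, hk⟩) (fun x _ hx => by simp [hx]) (by simp)]
  simp

open Classical in
lemma sum_matches_le (v : Fin (3 * N) → Bool) (K : ℕ → List Round → Round → ℝ)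
    (hK : ∀ k l r, 0 ≤ K k l r)
    (h : ∀ k l x y, ∑ a, ∑ b, ∑ c, K k l ⟨x, y, a, b, c⟩ ≤ 1) :
    (∑ t : Transcript N, if Matches v t then ∏ i : Fin N, K i (history t i) (t i) else 0) ≤ 1 := by
  simp only [← prod_matchKernel]
  refine sum_prod_history_le _ N (fun k l r => ?_) fun k hk l => ?_
  · unfold matchKernel
    split_ifs
    · exact hK ..
    · exact le_rfl
    · exact le_rfl
  · rw [sum_matchKernel v K hk]
    exact h ..

open Classical in
lemma sum_matches_boxWeight (hβ : ∀ l, InNPALevel (β l)) (v : Fin (3 * N) → Bool) :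
    (∑ t : Transcript N, if Matches v t then boxWeight β t else 0) = 1 := by
  have h : ∀ l x y, ∑ a, ∑ b, ∑ c, roundProb β l ⟨x, y, a, b, c⟩ = 1 := fun l x y =>
    (hβ l).sum_aliceMarginal x y (thirdSetting x y)
  refine le_antisymm (sum_matches_le v (fun _ => roundProb β) (fun _ => roundProb_nonneg hβ)
    fun _ l x y => (h l x y).le) ?_
  have h1 := one_le_sum_prod_history (matchKernel v fun _ => roundProb β) N fun k hk l => by
    rw [sum_matchKernel v _ hk, h]
  simp only [prod_matchKernel] at h1
  exact h1

open Classical in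
lemma Devices.prob_univ : prob (D.law e) Set.univ = 1 := by
  have h := sum_outcome fun v (t : Transcript N) =>
    (D.source e v).toReal * boxWeight (D.box e) t
  refine Eq.trans ?_ (h.trans ?_)
  · exact sum_congr rfl fun ω _ => (if_pos (Set.mem_univ ω)).trans (D.law_eq e ω)
  · rw [← sum_toReal_pmf (D.source e)]
    refine sum_congr rfl fun v _ => ?_
    simp only [← mul_ite_zero]
    rw [← mul_sum, sum_matches_boxWeight (D.inNPALevel e), mul_one]

/-- Probability of Alice's outcome in a round given its settings and the history. -/
def aliceProb (β : List Round → Behavior) (l : List Round) (r : Round) : ℝ :=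
  aliceMarginal (β l) r.a r.x r.y (thirdSetting r.x r.y)

open Classical in
-- The weight of a transcript factors into Alice's outcome probabilities, whose product is at most m
-- on S, times the conditional probabilities of the outcomes of Bob and Charlie. With Alice's string
-- fixed, the latter form a kernel of mass at most 1 per round. The event S may depend on the whole
-- transcript, since it is used only termwise.
lemma sum_matches_alice_le (hβ : ∀ l, InNPALevel (β l)) (v : Fin (3 * N) → Bool)
    (S : Set (Transcript N)) {m : ℝ} (hm : 0 ≤ m)
    (hS : ∀ t ∈ S, ∏ i, aliceProb β (history t i) (t i) ≤ m) (a : Fin N → Bool) :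
    (∑ t : Transcript N, if (Matches v t ∧ t ∈ S) ∧ ∀ i, (t i).a = a i then boxWeight β t else 0)
      ≤ m := by
  let K (k : ℕ) (l : List Round) (r : Round) : ℝ := if hk : k < N then
    if r.a = a ⟨k, hk⟩ then roundProb β l r / aliceProb β l r else 0 else 0
  have hA : ∀ l r, 0 ≤ aliceProb β l r := fun l r => (hβ l).aliceMarginal_nonneg ..
  have hle : ∀ l r, roundProb β l r ≤ aliceProb β l r := by
    intro l r
    refine le_trans ?_ (single_le_sum (f := fun b => ∑ c, β l r.a b c r.x r.y _)
      (fun b _ => sum_nonneg fun c _ => (hβ l).1 ..) (mem_univ r.b))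
    exact single_le_sum (f := fun c => β l r.a r.b c r.x r.y _)
      (fun c _ => (hβ l).1 ..) (mem_univ r.c)
  have h1 := sum_matches_le v K (fun k l r => ?_) fun k l x y => ?_
  · calc _ ≤ ∑ t : Transcript N, m * if Matches v t then ∏ i : Fin N, K i (history t i) (t i)
          else 0 := by
          refine sum_le_sum fun t _ => ?_
          have hK0 : 0 ≤ ∏ i : Fin N, K i (history t i) (t i) := prod_nonneg fun i _ => by
            dsimp only [K]
            split_ifs
            · exact div_nonneg (roundProb_nonneg hβ ..) (hA ..)
            · exact le_rfl
            · exact le_rfl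
          by_cases ht : (Matches v t ∧ t ∈ S) ∧ ∀ i, (t i).a = a i
          · rw [if_pos ht, if_pos ht.1.1]
            refine le_trans (le_of_eq ?_) (mul_le_mul_of_nonneg_right (hS t ht.1.2) hK0)
            rw [← prod_mul_distrib, boxWeight]
            refine prod_congr rfl fun i _ => ?_
            simp only [K, Fin.is_lt, dif_pos, Fin.eta, ht.2 i, if_true]
            rcases (hA (history t i) (t i)).eq_or_lt with h0 | h0
            -- If Alice's outcome has probability zero, so has the round, and the junk value of the
            -- quotient is harmless.
            · rw [← h0, zero_mul]
              exact le_antisymm (h0 ▸ hle ..) (roundProb_nonneg hβ ..)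
            · rw [mul_div_cancel₀ _ h0.ne']
          · rw [if_neg ht]
            split_ifs
            · exact mul_nonneg hm hK0
            · simp
      _ ≤ m := by
          rw [← mul_sum]
          exact mul_le_of_le_one_right hm h1
  · dsimp only [K]
    split_ifs
    · exact div_nonneg (roundProb_nonneg hβ ..) (hA ..)
    · exact le_rfl
    · exact le_rfl
  · by_cases hk : k < N
    · simp only [K, hk, dif_pos]
      rw [sum_eq_single (a ⟨k, hk⟩) (fun x _ hx => by simp [hx]) (by simp)]
      simp only [if_true, roundProb, aliceProb, ← sum_div]
      exact div_self_le_one (aliceMarginal (β l) (a ⟨k, hk⟩) x y (thirdSetting x y))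
    · simp [K, hk]

end

/-! ### Hashing -/

/-- The sign `(-1) ^ (h · a)`. -/
def character {N : ℕ} (h a : Fin N → Bool) : ℝ := ∏ i, if h i && a i then -1 else 1

lemma sum_character_mul {N : ℕ} (a a' : Fin N → Bool) :
    ∑ h, character h a * character h a' = if a = a' then 2 ^ N else 0 := by
  have h1 : ∑ h : Fin N → Bool, character h a * character h a' =
      ∏ i, ∑ b : Bool, (if b && a i then -1 else 1 : ℝ) * (if b && a' i then -1 else 1) := by
    rw [prod_univ_sum, Fintype.piFinset_univ]
    simp only [character, prod_mul_distrib]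
  have h2 : ∀ i, ∑ b : Bool, (if b && a i then -1 else 1 : ℝ) * (if b && a' i then -1 else 1) =
      if a i = a' i then 2 else 0 := by
    intro i
    rw [Fintype.sum_bool]
    cases a i <;> cases a' i <;> norm_num
  rw [h1, prod_congr rfl fun i _ => h2 i, prod_ite_zero]
  simp [funext_iff]

/-- Parseval turns the sum of squares into a collision probability, and a collision probability is
at most the largest point mass. -/
lemma sum_sq_character_le {T : Type*} [Fintype T] {N : ℕ} (c : T → ℝ) (a : T → Fin N → Bool)
    {m : ℝ} (hm : 0 ≤ m) (hc : ∀ t, 0 ≤ c t) (hc1 : ∑ t, c t ≤ 1)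
    (hcm : ∀ a₀, (∑ t, if a t = a₀ then c t else 0) ≤ m) :
    ∑ h, (∑ t, c t * character h (a t)) ^ 2 ≤ 2 ^ N * m := by
  calc ∑ h, (∑ t, c t * character h (a t)) ^ 2
      = ∑ h, ∑ t, ∑ t', c t * c t' * (character h (a t') * character h (a t)) := by
        refine sum_congr rfl fun h _ => ?_
        rw [pow_two, sum_mul_sum]
        exact sum_congr rfl fun t _ => sum_congr rfl fun t' _ => by ring
    _ = ∑ t, ∑ t', c t * c t' * if a t' = a t then 2 ^ N else 0 := by
        rw [sum_comm]
        refine sum_congr rfl fun t _ => ?_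
        rw [sum_comm]
        refine sum_congr rfl fun t' _ => ?_
        rw [← mul_sum, sum_character_mul]
    _ = ∑ t, 2 ^ N * (c t * ∑ t', if a t' = a t then c t' else 0) := by
        refine sum_congr rfl fun t _ => ?_
        rw [mul_sum, mul_sum]
        refine sum_congr rfl fun t' _ => ?_
        split_ifs <;> ring
    _ ≤ ∑ t, 2 ^ N * (c t * m) := sum_le_sum fun t _ => by
        have := hc t
        have := hcm (a t)
        gcongr
    _ = 2 ^ N * m * ∑ t, c t := by
        rw [mul_sum]
        exact sum_congr rfl fun t _ => by ring
    _ ≤ 2 ^ N * m := mul_le_of_le_one_right (by positivity) hc1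

section

variable {N : ℕ}

lemma character_eq_outputBit (ω : Outcome N) :
    character (hBit ω.1) (fun i => (transcript ω i).a) = if outputBit ω then -1 else 1 := by
  have h1 : character (hBit ω.1) (fun i => (transcript ω i).a) =
      (-1) ^ ∑ i, (hBit ω.1 i && (ω.2 i).1).toNat := by
    rw [← prod_pow_eq_pow_sum]
    refine prod_congr rfl fun i _ => ?_
    simp only [transcript]
    rcases Bool.eq_false_or_eq_true (hBit ω.1 i && (ω.2 i).1) with h | h <;> simp [h]
  rw [h1, outputBit]
  by_cases h : Odd (∑ i, (hBit ω.1 i && (ω.2 i).1).toNat)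
  · simp [h]
  · simp [h, (Nat.not_odd_iff_even.1 h).neg_one_pow]

/-- Two source strings that agree on the settings. -/
def SameSettings (v v' : Fin (3 * N) → Bool) : Prop :=
  ∀ j : Fin (3 * N), (j : ℕ) < 2 * N → v' j = v j

lemma SameSettings.matches_iff {v v' : Fin (3 * N) → Bool} (h : SameSettings v v')
    (t : Transcript N) : Matches v t ↔ Matches v' t := by
  rw [MerminAmp.matches_iff, MerminAmp.matches_iff]
  exact forall_congr' fun j => forall_congr' fun hj => by rw [h j hj]

open Classical in
lemma sum_sameSettings (v' : Fin (3 * N) → Bool) (f : (Fin N → Bool) → ℝ) :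
    (∑ v, if SameSettings v v' then f (hBit v) else 0) = ∑ h, f h := by
  rw [← sum_filter]
  refine sum_nbij' hBit (fun h j => if hj : (j : ℕ) < 2 * N then v' j else h ⟨j - 2 * N, by omega⟩)
    (fun _ _ => mem_univ _) (fun h _ => ?_) (fun v hv => ?_) (fun h _ => ?_) (fun _ _ => rfl)
  · refine mem_filter.2 ⟨mem_univ _, fun j hj => ?_⟩
    simp [hj]
  · funext j
    have h := (mem_filter.1 hv).2 j
    split_ifs with hj
    · exact h hj
    · exact congrArg v (Fin.ext (by dsimp only; omega))
  · funext i
    rw [hBit, dif_neg (by dsimp only; omega)]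
    exact congrArg h (Fin.ext (by dsimp only; omega))

variable {ε : ℝ} {E : Type*} (D : Devices ε E N) (e : E)

open Classical in
-- The sum is the probability of the settings of v, and each of the N hashing bits that follow costs
-- a factor of at most 1/2 + ε.
lemma source_le (hε : 0 < ε) {μ : PMF (Fin (3 * N) → Bool)} (hμ : IsSanthaVazirani ε μ)
    (v : Fin (3 * N) → Bool) :
    (μ v).toReal ≤ (1 / 2 + ε) ^ N * ∑ v', if SameSettings v v' then (μ v').toReal else 0 := by
  let w : ℕ → Bool := fun j => if h : j < 3 * N then v ⟨j, h⟩ else false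
  have hw : ∀ j : Fin (3 * N), w j = v j := fun j => by simp [w]
  have h1 := prefixProb_add_le hε hμ w (2 * N) N (by omega)
  rw [show 2 * N + N = 3 * N by ring, prefixProb_top μ v hw] at h1
  refine h1.trans_eq (congrArg _ (sum_congr rfl fun v' _ => ?_))
  by_cases h : SameSettings v v'
  · rw [if_pos h]
    exact if_pos fun j hj => (h j hj).trans (hw j).symm
  · rw [if_neg h]
    exact if_neg fun h' => h fun j hj => (h' j hj).trans (hw j)

open Classical in
-- Cauchy–Schwarz with respect to the source replaces the signed mean by a mean of squares. After
-- bounding the source by `source_le`, the hashing bits are summed uniformly for fixed settings, and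
-- Parseval applies with collision bound m. The total is (1/2 + ε)^N 2^N m.
lemma Devices.sq_signed_prob_le (hε : 0 < ε) (S : Set (Transcript N)) {m : ℝ} (hm : 0 ≤ m)
    (hS : ∀ t ∈ S, ∏ i, aliceProb (D.box e) (history t i) (t i) ≤ m) :
    (∑ ω, if transcript ω ∈ S then D.law e ω * (if outputBit ω then -1 else 1) else 0) ^ 2 ≤
      (1 + 2 * ε) ^ N * m := by
  set μ := D.source e with hμdef
  have hμ0 : ∀ v, 0 ≤ (μ v).toReal := fun v => ENNReal.toReal_nonneg
  have hβ := D.inNPALevel e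
  let c (v : Fin (3 * N) → Bool) (t : Transcript N) : ℝ :=
    if Matches v t ∧ t ∈ S then boxWeight (D.box e) t else 0
  let a (t : Transcript N) : Fin N → Bool := fun i => (t i).a
  let T (v : Fin (3 * N) → Bool) : ℝ := ∑ t, c v t * character (hBit v) (a t)
  have hc0 : ∀ v t, 0 ≤ c v t := fun v t => by
    dsimp only [c]
    split_ifs
    · exact boxWeight_nonneg hβ t
    · exact le_rfl
  have hsum : (∑ ω, if transcript ω ∈ S then D.law e ω * (if outputBit ω then -1 else 1) else 0) =
      ∑ v, (μ v).toReal * T v := by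
    have h := sum_outcome fun v (t : Transcript N) => if t ∈ S then
      (μ v).toReal * boxWeight (D.box e) t * character (hBit v) (a t) else 0
    refine Eq.trans (sum_congr rfl fun ω _ => ?_) (h.trans (sum_congr rfl fun v _ => ?_))
    · rw [← character_eq_outputBit, D.law_eq]
    · rw [mul_sum]
      refine sum_congr rfl fun t _ => ?_
      by_cases h1 : Matches v t <;> by_cases h2 : t ∈ S <;> simp [c, h1, h2, mul_assoc]
  have hparseval : ∀ v', (∑ v, if SameSettings v v' then T v ^ 2 else 0) ≤ 2 ^ N * m := by
    intro v'
    -- Box weights see a source string only through its settings, so those of v' serve for all v in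
    -- the class and only the hashing bits vary.
    have h1 : ∀ v, (if SameSettings v v' then T v ^ 2 else 0) = if SameSettings v v' then
        (∑ t, c v' t * character (hBit v) (a t)) ^ 2 else 0 := fun v => by
      split_ifs with h
      · simp only [T, c, h.matches_iff]
      · rfl
    rw [sum_congr rfl fun v _ => h1 v,
      sum_sameSettings v' fun h => (∑ t, c v' t * character h (a t)) ^ 2]
    refine sum_sq_character_le _ _ hm (hc0 v') ?_ fun a₀ => ?_
    · rw [← sum_matches_boxWeight hβ v']
      refine sum_le_sum fun t _ => ?_
      by_cases h1 : Matches v' t <;> by_cases h2 : t ∈ S <;>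
        simp [c, h1, h2, boxWeight_nonneg hβ t]
    · refine le_trans (le_of_eq (sum_congr rfl fun t _ => ?_))
        (sum_matches_alice_le hβ v' S hm hS a₀)
      by_cases h1 : Matches v' t ∧ t ∈ S <;> by_cases h2 : ∀ i, (t i).a = a₀ i <;>
        simp [c, a, h1, h2, funext_iff]
  rw [hsum]
  calc (∑ v, (μ v).toReal * T v) ^ 2
      = (∑ v, √(μ v).toReal * (√(μ v).toReal * T v)) ^ 2 := by
        simp only [← mul_assoc, Real.mul_self_sqrt (hμ0 _)]
    _ ≤ (∑ v, √(μ v).toReal ^ 2) * ∑ v, (√(μ v).toReal * T v) ^ 2 := sum_mul_sq_le_sq_mul_sq ..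
    _ = ∑ v, (μ v).toReal * T v ^ 2 := by
        simp only [mul_pow, Real.sq_sqrt (hμ0 _), sum_toReal_pmf, one_mul]
    _ ≤ ∑ v, ((1 / 2 + ε) ^ N * ∑ v', if SameSettings v v' then (μ v').toReal else 0) * T v ^ 2 :=
        sum_le_sum fun v _ =>
          mul_le_mul_of_nonneg_right (source_le hε (D.source_free e) v) (sq_nonneg _)
    _ = (1 / 2 + ε) ^ N * ∑ v', (μ v').toReal * ∑ v, if SameSettings v v' then T v ^ 2 else 0 := by
        simp only [mul_assoc, ← mul_sum, sum_mul]
        congr 1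
        rw [sum_comm]
        refine sum_congr rfl fun v' _ => ?_
        rw [mul_sum]
        refine sum_congr rfl fun v _ => ?_
        split_ifs <;> simp
    _ ≤ (1 / 2 + ε) ^ N * ∑ v', (μ v').toReal * (2 ^ N * m) := by
        refine mul_le_mul_of_nonneg_left ?_ (by positivity)
        exact sum_le_sum fun v' _ => mul_le_mul_of_nonneg_left (hparseval v') (hμ0 v')
    _ = (1 + 2 * ε) ^ N * m := by
        rw [← sum_mul, sum_toReal_pmf, one_mul, ← mul_assoc, ← mul_pow]
        congr 2
        ring

end

/-! ### The output bit -/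

/-- The event that the number of lost rounds is not much below its expectation for a
Santha–Vazirani source. -/
def typical {ε : ℝ} {E : Type*} {N : ℕ} (D : Devices ε E N) (e : E) (c : ℝ) :
    Set (Transcript N) :=
  {t | ∑ i, excess ε (D.box e) (history t i) (t i) < N * c}

section

variable {ε : ℝ} {E : Type*} {N : ℕ} (D : Devices ε E N) (e : E)

lemma Devices.prob_compl (S : Set (Outcome N)) : prob (D.law e) Sᶜ = 1 - prob (D.law e) S := by
  have h := prob_inter_add_inter_compl (D.law e) S Set.univ
  rw [D.prob_univ, Set.inter_univ, Set.inter_univ] at h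
  linarith

lemma Devices.prob_typical_ge (hε : 0 < ε) (hε' : ε < 1 / 2) {c : ℝ} (hc : 0 ≤ c) (hc1 : c ≤ 1) :
    1 - Real.exp (-(c ^ 2 / 4)) ^ N ≤ prob (D.law e) {ω | transcript ω ∈ typical D e c} := by
  have h := sum_excess_ge_le (D.source_free e) (D.inNPALevel e) hε hε' hc hc1
    (by omega : 2 * N ≤ 3 * N)
  have h1 := D.prob_transcript e (typical D e c)ᶜ
  have h2 := D.prob_compl e {ω | transcript ω ∈ typical D e c}
  have h3 : {ω : Outcome N | transcript ω ∈ typical D e c}ᶜ =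
    {ω | transcript ω ∈ (typical D e c)ᶜ} := rfl
  rw [h3, h1] at h2
  have h4 : (∑ t : Transcript N, if N * c ≤ ∑ i, excess ε (D.box e) (history t i) (t i) then
      prefixProb (D.source e) (2 * N) (settings t) * boxWeight (D.box e) t else 0) =
      1 - prob (D.law e) {ω | transcript ω ∈ typical D e c} := by
    rw [← h2]
    refine sum_congr rfl fun t _ => ?_
    by_cases ht : N * c ≤ ∑ i, excess ε (D.box e) (history t i) (t i)
    · rw [if_pos ht]
      exact (if_pos (not_lt.2 ht : t ∉ typical D e c)).symm
    · rw [if_neg ht]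
      exact (if_neg (fun h : t ∉ typical D e c => ht (not_lt.1 h))).symm
  linarith

/-- A bit is nearly unbiased conditionally on an event of large probability if its sign has a small
expectation on that event. -/
lemma Devices.condProb_outputBit_mem (S : Set (Transcript N)) {δ η : ℝ} (hδ : 0 ≤ δ) (hη : 0 < η)
    (hS : η ≤ prob (D.law e) {ω | transcript ω ∈ S})
    (h : open Classical in
      (∑ ω, if transcript ω ∈ S then D.law e ω * (if outputBit ω then -1 else 1) else 0) ^ 2 ≤
        (2 * δ * η) ^ 2) (v : Bool) :
    condProb (D.law e) {ω | outputBit ω = v} {ω | transcript ω ∈ S} ∈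
      Set.Icc (1 / 2 - δ) (1 / 2 + δ) := by
  classical
  set p := prob (D.law e) {ω | transcript ω ∈ S} with hp
  have h1 : prob (D.law e) ({ω | outputBit ω = false} ∩ {ω | transcript ω ∈ S}) +
      prob (D.law e) ({ω | outputBit ω = true} ∩ {ω | transcript ω ∈ S}) = p := by
    rw [prob, prob, ← sum_add_distrib, hp, prob]
    refine sum_congr rfl fun ω _ => ?_
    by_cases h : transcript ω ∈ S <;> cases h2 : outputBit ω <;> simp [h, h2]
  have h2 : prob (D.law e) ({ω | outputBit ω = false} ∩ {ω | transcript ω ∈ S}) -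
      prob (D.law e) ({ω | outputBit ω = true} ∩ {ω | transcript ω ∈ S}) =
      ∑ ω, if transcript ω ∈ S then D.law e ω * (if outputBit ω then -1 else 1) else 0 := by
    rw [prob, prob, ← sum_sub_distrib]
    refine sum_congr rfl fun ω _ => ?_
    by_cases h : transcript ω ∈ S <;> cases h2 : outputBit ω <;> simp [h, h2]
  have h3 := abs_le_of_sq_le_sq' h (by positivity)
  rw [← h2] at h3
  have hp0 : 0 < p := hη.trans_le hS
  have h4 : δ * η ≤ δ * p := mul_le_mul_of_nonneg_left hS hδ
  rw [condProb, ← hp, Set.mem_Icc, le_div_iff₀ hp0, div_le_iff₀ hp0]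
  cases v <;> constructor <;> linarith [h3.1, h3.2]

end

/-- AM–GM, through u ≤ exp(u - 1) applied to u = f i / m. -/
lemma prod_le_pow_of_sum_le {N : ℕ} {f : Fin N → ℝ} {m : ℝ} (hm : 0 < m) (hf : ∀ i, 0 ≤ f i)
    (h : ∑ i, f i ≤ N * m) : ∏ i, f i ≤ m ^ N := by
  calc ∏ i, f i ≤ ∏ i, m * Real.exp (f i / m - 1) := by
        refine prod_le_prod (fun i _ => hf i) fun i _ => ?_
        have := Real.add_one_le_exp (f i / m - 1)
        rw [sub_add_cancel, div_le_iff₀ hm] at this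
        linarith
    _ = m ^ N * Real.exp ((∑ i, f i) / m - N) := by
        rw [prod_mul_distrib, ← Real.exp_sum, sum_sub_distrib, sum_div]
        simp
    _ ≤ m ^ N := by
        refine mul_le_of_le_one_right (by positivity) (Real.exp_le_one_iff.2 ?_)
        rw [sub_nonpos, div_le_iff₀ hm]
        exact h

lemma r_nonneg (q : ℝ) (N : ℕ) : 0 ≤ r q N := by
  unfold r
  positivity

lemma tendsto_r (q : ℝ) : Filter.Tendsto (r q) Filter.atTop (nhds 0) :=
  Filter.Tendsto.const_div_atTop
    (Real.tendsto_sqrt_atTop.comp tendsto_natCast_atTop_atTop) _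

lemma sum_excess_eq {N : ℕ} (hN : 0 < N) (ε : ℝ) (β : List Round → Behavior) (t : Transcript N) :
    ∑ i, excess ε β (history t i) (t i) =
      ∑ i, 4 * (1 / 2 - ε) ^ 2 * (1 - unbiasedWinProb (β (history t i))) - N * (1 - pEst t) := by
  have hN' : (N : ℝ) ≠ 0 := by positivity
  have h : ∑ i, (if Wins (t i).x (t i).y (t i).a (t i).b (t i).c then (0 : ℝ) else 1) =
      N * (1 - pEst t) := by
    have h1 : ∀ i, (if Wins (t i).x (t i).y (t i).a (t i).b (t i).c then (0 : ℝ) else 1) =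
        1 - if Wins (t i).x (t i).y (t i).a (t i).b (t i).c then (1 : ℝ) else 0 := fun i => by
      split_ifs <;> simp
    rw [sum_congr rfl fun i _ => h1 i, sum_sub_distrib, sum_boole, pEst, mul_sub,
      mul_div_cancel₀ _ hN']
    simp
  rw [← h, ← sum_sub_distrib]
  rfl

end MerminAmp

end

/-! ### Choice of the event and conclusion -/

theorem mainTheorem3 (ε ε' q : ℝ) (hε'_pos : 0 < ε') (hε'_lt : ε' < ε) (hε_lt : ε < 1 / 2)
    (hq_nonneg : 0 ≤ q) (hq_lt : q < 1) :
    ∃ N₀ : ℕ, ∀ N : ℕ, N₀ ≤ N →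
      MerminAmp.g ε (1 - MerminAmp.r q N) < 1 / (1 + 2 * ε) - 1 / 2 ∧
      ∀ (E : Type*) (D : MerminAmp.Devices ε E N) (e : E),
        ∃ G : Set (MerminAmp.Transcript N),
          q ≤ MerminAmp.prob (D.law e) {ω | MerminAmp.transcript ω ∈ G} ∧
          (0 < MerminAmp.prob (D.law e)
              {ω | MerminAmp.transcript ω ∈ G ∧ MerminAmp.Passes ε q (MerminAmp.transcript ω)} →
            ∀ v : Bool,
              MerminAmp.condProb (D.law e) {ω | MerminAmp.outputBit ω = v}
                {ω | MerminAmp.transcript ω ∈ G ∧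
                  MerminAmp.Passes ε q (MerminAmp.transcript ω)}
                ∈ Set.Icc (1 / 2 - ε') (1 / 2 + ε')) := by
  open MerminAmp in
  have hε : 0 < ε := hε'_pos.trans hε'_lt
  obtain ⟨d, m, hd, hd1, hm, hm1, hpass, hbound⟩ := exists_uniform_bound hε hε_lt
  -- Half of 1 - q bounds the probability of atypical transcripts; the other half remains as a lower
  -- bound for the conditioning event.
  have hη : 0 < (1 - q) / 2 := by linarith
  have hρ := tendsto_pow_atTop_nhds_zero_of_lt_one (Real.exp_pos (-(d ^ 2 / 4))).le
    (Real.exp_lt_one_iff.2 (by have := pow_pos hd 2; linarith : -(d ^ 2 / 4) < 0))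
  have hθ := tendsto_pow_atTop_nhds_zero_of_lt_one (r := (1 + 2 * ε) * m) (by positivity)
    (by linarith)
  obtain ⟨N₀, hN₀⟩ := Filter.eventually_atTop.1
    (((hρ.eventually_lt_const hη).and
      (hθ.eventually_lt_const (by positivity : 0 < (2 * ε' * ((1 - q) / 2)) ^ 2))).and
    (((tendsto_r q).eventually_lt_const hd).and (Filter.eventually_gt_atTop 0)))
  refine ⟨N₀, fun N hN => ?_⟩
  obtain ⟨⟨hρN, hθN⟩, hrN, hN0⟩ := hN₀ N hN
  refine ⟨hpass _ (by linarith), fun E D e => ?_⟩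
  -- Conditioning on the test is meaningful only if it is passed with probability above `1 - q`.
  rcases le_or_gt (prob (D.law e) {ω | Passes ε q (transcript ω)}) (1 - q) with hp | hp
  -- Failing the test has probability at least q and is disjoint from passing it, so the conditional
  -- claim is void.
  · refine ⟨{t | ¬Passes ε q t}, ?_, fun h => absurd h ?_⟩
    · have := D.prob_compl e {ω | Passes ε q (transcript ω)}
      change q ≤ prob (D.law e) {ω | Passes ε q (transcript ω)}ᶜ
      linarith
    · have : {ω : Outcome N | transcript ω ∈ {t | ¬Passes ε q t} ∧ Passes ε q (transcript ω)} = ∅ :=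
        Set.eq_empty_of_forall_notMem fun ω hω => hω.1 hω.2
      rw [this]
      simp [prob]
  · have htyp := D.prob_typical_ge e hε hε_lt hd.le hd1
    refine ⟨typical D e d, by linarith, fun _ => ?_⟩
    refine D.condProb_outputBit_mem e (typical D e d ∩ {t | Passes ε q t}) hε'_pos.le hη ?_ ?_
    · have h1 := prob_inter_add_inter_compl (D.law e) {ω | transcript ω ∈ typical D e d}
        {ω | Passes ε q (transcript ω)}
      have h2 := prob_mono (D.law_nonneg e)
        (Set.inter_subset_left (s := {ω | transcript ω ∈ typical D e d}ᶜ)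
          (t := {ω | Passes ε q (transcript ω)}))
      rw [D.prob_compl] at h2
      change _ ≤ prob (D.law e)
        ({ω | transcript ω ∈ typical D e d} ∩ {ω | Passes ε q (transcript ω)})
      linarith
    · refine (D.sq_signed_prob_le e hε _ (pow_nonneg hm.le N) fun t ht => ?_).trans
        (by rw [← mul_pow]; exact hθN.le)
      refine prod_le_pow_of_sum_le hm (fun i => (D.inNPALevel e _).aliceMarginal_nonneg ..) ?_
      -- The average is taken over the behaviours met along the given transcript, with the realized
      -- settings and outcomes of Alice.
      refine hbound N hN0 (fun i => D.box e (history t i)) _ _ _ (pEst t - r q N)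
        (fun i => D.box_quantum e _) ht.2 ?_
      have h1 : ∑ i, excess ε (D.box e) (history t i) (t i) < N * d := ht.1
      rw [sum_excess_eq hN0] at h1
      have h2 : 0 ≤ N * r q N := mul_nonneg (Nat.cast_nonneg N) (r_nonneg q N)
      linarith
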